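/- Let $\mathcal M$ be a matroid on a finite ground set $E$, and let $M(\mathbf y)=\sum_{B}\prod_{e\in B}y_e$ be its basis-generating polynomial, the sum being over all bases $B$ of $\mathcal M$. $\mathcal M$ has the half-plane property (is HPP) if $M(\mathbf y)\neq 0$ for all $\mathbf y\in\mathbb C^E$ with $\operatorname{Re}(y_e)>0$ for every $e\in E$. $\mathcal M$ is strongly Rayleigh if for all distinct $e,f\in E$ and all $\mathbf y\in\mathbb R^E$, $$\Delta M\{e,f\}(\mathbf y)=\frac{\partial M}{\partial y_e}\frac{\partial M}{\partial y_f}-\frac{\partial^2 M}{\partial y_e\,\partial y_f}\,M\ \ge\ 0 .$$ (For matroids these two properties are known to be equivalent.) Consider the following matroids. In each matroid of rank three below, the bases are the three-element sets not contained in a listed line (so the listed lines are exactly the lines with at least three points). 1. $\mathcal F_7^{-4}$: rank $3$ on $\{1,\dots,7\}$, lines $123,\ 147,\ 156$. 2. $\mathcal W^{3+}$: rank $3$ on $\{1,\dots,7\}$, lines $1237,\ 345,\ 156$. 3. $\mathcal W^3+e$: rank $3$ on $\{1,\dots,7\}$, lines $123,\ 345,\ 156$. 4. $\mathcal P_7'$: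 rank $3$ on $\{1,\dots,7\}$, lines $123,\ 156,\ 267,\ 345$. 5. $n\mathcal P\smallsetminus 1$ and 6. $n\mathcal P\smallsetminus 9$: the deletions of the points $1$ and $9$ from the non-Pappus matroid $n\mathcal P$, of rank $3$ on $\{1,\dots,9\}$, with lines $123,\ 456,\ 157,\ 247,\ 168,\ 348,\ 269,\ 359$. 7. The Vámos cube $\mathcal V_8$: rank $4$ on $\{1,\dots,8\}$, whose bases are all four-element sets except $1234,\ 1456,\ 1478,\ 2356,\ 2378$. Each of these seven matroids has the half-plane property, and each is strongly Rayleigh. -/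

import Mathlib

open Finset MvPolynomial

section RealPolynomials

variable {σ : Type*}

/-- The Rayleigh difference `ΔZ{e,f} = Z_e Z_f - Z_{ef} Z`, where subscripts are partial
derivatives. -/
noncomputable def rayleighDiff (Z : MvPolynomial σ ℝ) (e f : σ) : MvPolynomial σ ℝ :=
  pderiv e Z * pderiv f Z - pderiv e (pderiv f Z) * Z

/-- The strong Rayleigh property of a polynomial `Z` in variables indexed by `E`. -/
def IsStronglyRayleigh (E : Set σ) (Z : MvPolynomial σ ℝ) : Prop :=
  ∀ y : σ → ℝ, ∀ e ∈ E, ∀ f ∈ E, e ≠ f → 0 ≤ eval y (rayleighDiff Z e f)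

/-- The half-plane property (Hurwitz stability) of a polynomial `Z` in variables indexed
by `E`. -/
def HasHalfPlaneProperty (E : Set σ) (Z : MvPolynomial σ ℝ) : Prop :=
  ∀ y : σ → ℂ, (∀ e ∈ E, 0 < (y e).re) → aeval y Z ≠ 0

end RealPolynomials

namespace Matroid

variable {α : Type*}

open scoped Classical in
/-- The basis-generating polynomial `M(y) = ∑_B ∏_{e ∈ B} y_e`, the sum being over all bases
`B` of the finite matroid `M`. -/
noncomputable def basisPoly (M : Matroid α) [M.Finite] : MvPolynomial α ℝ :=
  ∑ B ∈ M.ground_finite.toFinset.powerset.filter (fun B : Finset α => M.IsBase (B : Set α)),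
    ∏ e ∈ B, X e

/-- A finite matroid is strongly Rayleigh if its basis-generating polynomial is. -/
def StronglyRayleigh (M : Matroid α) [M.Finite] : Prop :=
  IsStronglyRayleigh M.E M.basisPoly

/-- A finite matroid is HPP if its basis-generating polynomial has the half-plane property. -/
def HPP (M : Matroid α) [M.Finite] : Prop :=
  HasHalfPlaneProperty M.E M.basisPoly

variable [DecidableEq α]

/-- The matroid with ground set `E` whose bases are the `r`-element subsets of `E` that are not
contained in a member of the family `L` (for `r = 3`: the noncollinear triples, where `L` is the
list of lines with at least three points). It is assumed that distinct members of `L` have at most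
`r - 2` common elements, and that some `r`-element set is not contained in a member of `L`. -/
def paving (E : Finset α) (r : ℕ) (L : Finset (Finset α))
    (hL : ∀ A ∈ L, ∀ B ∈ L, A ≠ B → (A ∩ B).card + 2 ≤ r)
    (hne : ∃ B : Finset α, B ⊆ E ∧ B.card = r ∧ ∀ A ∈ L, ¬ B ⊆ A) : Matroid α :=
  Matroid.ofIsBaseOfFinite (E := (E : Set α)) E.finite_toSet
    (fun B => ∃ C : Finset α, (C : Set α) = B ∧ C ⊆ E ∧ C.card = r ∧ ∀ A ∈ L, ¬ C ⊆ A)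
    (by
      obtain ⟨B, hB⟩ := hne
      exact ⟨B, B, rfl, hB⟩)
    (by
      rintro _ _ ⟨B, rfl, hBE, hBr, hBL⟩ ⟨C, rfl, hCE, hCr, hCL⟩ a ha
      have haB : a ∈ B := by simpa using ha.1
      have haC : a ∉ C := by simpa using ha.2
      have hS : (B.erase a).card + 1 = r := by rw [card_erase_add_one haB, hBr]
      by_contra hcon
      have key : ∀ b ∈ C \ B, ∃ A ∈ L, insert b (B.erase a) ⊆ A := by
        intro b hb
        rw [mem_sdiff] at hb
        by_contra hno
        push Not at hno
        refine hcon ⟨b, by simpa using hb, insert b (B.erase a), by simp, ?_, ?_, hno⟩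
        · exact insert_subset (hCE hb.1) ((erase_subset _ _).trans hBE)
        · rw [card_insert_of_notMem (fun h => hb.2 (mem_of_mem_erase h)), hS]
      obtain ⟨b, hb⟩ : (C \ B).Nonempty := by
        rw [sdiff_nonempty]
        intro hCB
        exact haC (eq_of_subset_of_card_le hCB (by omega) ▸ haB)
      obtain ⟨A, hA, hbA⟩ := key b hb
      refine hCL A hA fun c hc => ?_
      by_cases hcB : c ∈ B
      · exact hbA (mem_insert_of_mem (mem_erase.2 ⟨fun h => haC (h ▸ hc), hcB⟩))
      · obtain ⟨A', hA', hcA'⟩ := key c (mem_sdiff.2 ⟨hc, hcB⟩)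
        have hAA : A = A' := by
          by_contra hAA
          have h1 := hL A hA A' hA' hAA
          have h2 : B.erase a ⊆ A ∩ A' :=
            subset_inter ((subset_insert _ _).trans hbA) ((subset_insert _ _).trans hcA')
          have h3 := card_le_card h2
          omega
        exact hAA ▸ hcA' (mem_insert_self _ _))
    (by
      rintro _ ⟨B, rfl, hBE, -⟩
      exact_mod_cast hBE)

instance paving_finite (E : Finset α) (r : ℕ) (L : Finset (Finset α)) (hL) (hne) :
    (paving E r L hL hne).Finite :=
  ⟨E.finite_toSet⟩

/-- `F₇⁻⁴`: seven points in rank three; the lines with more than two points are three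
three-point lines through a common point. -/
def F7m4 : Matroid ℕ :=
  paving (Icc 1 7) 3 {{1, 2, 3}, {1, 4, 7}, {1, 5, 6}} (by decide) ⟨{1, 2, 4}, by decide⟩

/-- `W³⁺`: the rank-three whirl with points `1, …, 6` (lines `123`, `345`, `156`), and a further
point `7` placed freely on the line `123`. -/
def W3plus : Matroid ℕ :=
  paving (Icc 1 7) 3 {{1, 2, 3, 7}, {3, 4, 5}, {1, 5, 6}} (by decide) ⟨{1, 2, 4}, by decide⟩

/-- `W³ + e`: the rank-three whirl with points `1, …, 6` (lines `123`, `345`, `156`), and a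
further point `7` placed freely in the plane. -/
def W3adde : Matroid ℕ :=
  paving (Icc 1 7) 3 {{1, 2, 3}, {3, 4, 5}, {1, 5, 6}} (by decide) ⟨{1, 2, 4}, by decide⟩

/-- `P₇'`: seven points in rank three; the lines with more than two points are the four
three-point lines `123`, `156`, `267`, `345`. -/
def P7prime : Matroid ℕ :=
  paving (Icc 1 7) 3 {{1, 2, 3}, {1, 5, 6}, {2, 6, 7}, {3, 4, 5}} (by decide)
    ⟨{1, 2, 4}, by decide⟩

/-- The non-Pappus matroid `nP`: the eight three-point lines are those of the Pappus
configuration, except `789`. -/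
def nonPappus : Matroid ℕ :=
  paving (Icc 1 9) 3
    {{1, 2, 3}, {4, 5, 6}, {1, 5, 7}, {2, 4, 7}, {1, 6, 8}, {3, 4, 8}, {2, 6, 9}, {3, 5, 9}}
    (by decide) ⟨{1, 2, 4}, by decide⟩

/-- The Vámos cube `V₈`: of rank four, with exactly five four-point planes. With the pairs
`a = 14`, `b = 23`, `c = 56`, `d = 78` these are `ab`, `ac`, `ad`, `bc`, `bd` (but not `cd`). -/
def vamos : Matroid ℕ :=
  paving (Icc 1 8) 4
    {{1, 2, 3, 4}, {1, 4, 5, 6}, {1, 4, 7, 8}, {2, 3, 5, 6}, {2, 3, 7, 8}}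
    (by decide) ⟨{1, 2, 3, 5}, by decide⟩

instance : F7m4.Finite := paving_finite ..
instance : W3plus.Finite := paving_finite ..
instance : W3adde.Finite := paving_finite ..
instance : P7prime.Finite := paving_finite ..
instance : nonPappus.Finite := paving_finite ..
instance : vamos.Finite := paving_finite ..

end Matroid

/-! For a multiaffine `Z`, view `ΔZ{e,f}` as a quadratic in `y_g`: its leading coefficient is
`ΔZ_g{e,f}`, and its discriminant is symmetric in `e`, `f`, `g`. Hence `ΔZ{e,f} ≥ 0` bounds the
discriminant of `ΔZ{e,g}` in `y_f`, and wherever the leading coefficient `ΔZ_f{e,g}` is positive,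
`ΔZ{e,g}` is nonnegative too (`rayleighDiff_nonneg_of_contract`). So a single nonnegative Rayleigh
difference suffices once two contractions are known to be strongly Rayleigh
(`IsStronglyRayleigh.of_pair`).

In rank three these contractions have rank two and are settled by class sums
(`isStronglyRayleigh_of_rank_two`). For the Vámos cube, the contractions of `1` and `2` are copies
of `F₇⁻⁴`. The one remaining inequality for each matroid is an explicit sum of squares.

The half-plane property follows by induction on the variables (`IsStronglyRayleigh.aeval_ne_zero`):
positivity of the Rayleigh differences keeps the zeros of `Z` out of the product of upper half
planes, and homogeneity allows a rotation to the right half planes. -/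

namespace MvPolynomial

/-! ### Partial derivatives of multiaffine polynomials. -/

variable {σ : Type*}

lemma pderiv_pderiv_comm {R : Type*} [CommRing R] (e f : σ) (Z : MvPolynomial σ R) :
    pderiv e (pderiv f Z) = pderiv f (pderiv e Z) := by
  classical
  have h : ⁅pderiv (R := R) e, pderiv (R := R) f⁆ = 0 := by
    refine MvPolynomial.derivation_ext fun i => ?_
    simp only [Derivation.commutator_apply, pderiv_X, Derivation.coe_zero, Pi.zero_apply]
    simp only [Pi.single_apply]
    split_ifs <;> simp
  have := congrArg (fun D => D Z) h
  simpa [Derivation.commutator_apply, sub_eq_zero] using this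

/-- A polynomial of degree at most one in each variable. -/
def IsMultiaffine (Z : MvPolynomial σ ℝ) : Prop := ∀ e, pderiv e (pderiv e Z) = 0

lemma IsMultiaffine.pderiv {Z : MvPolynomial σ ℝ} (h : IsMultiaffine Z) (g : σ) :
    IsMultiaffine (MvPolynomial.pderiv g Z) := fun e => by
  rw [pderiv_pderiv_comm e g, pderiv_pderiv_comm e g, h e, map_zero]

lemma notMem_vars_of_pderiv_eq_zero {Z : MvPolynomial σ ℝ} {i : σ} (h : pderiv i Z = 0) :
    i ∉ Z.vars := by
  classical
  rw [mem_vars_iff_mem_support]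
  rintro ⟨m, hm, hi⟩
  -- In characteristic zero, the coefficient of `m` reappears in the derivative at `m - single i 1`,
  -- multiplied by the nonzero exponent `m i`.
  have h1 := congrArg (coeff (m - Finsupp.single i 1)) h
  rw [coeff_pderiv, coeff_zero] at h1
  have h2 : m - Finsupp.single i 1 + Finsupp.single i 1 = m := by
    refine tsub_add_cancel_of_le ?_
    rw [Finsupp.single_le_iff]
    exact Nat.one_le_iff_ne_zero.2 (Finsupp.mem_support_iff.1 hi)
  rw [h2] at h1
  rcases mul_eq_zero.1 h1 with h3 | h3
  · exact (mem_support_iff.1 hm) h3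
  · norm_cast at h3

lemma aeval_congr_of_pderiv_eq_zero {K : Type*} [CommRing K] [Algebra ℝ K]
    {Z : MvPolynomial σ ℝ} {E : Finset σ} (h : ∀ i ∉ E, pderiv i Z = 0) {v w : σ → K}
    (hvw : ∀ i ∈ E, v i = w i) : aeval v Z = aeval w Z := by
  refine eval₂Hom_congr' rfl (fun i hi _ => hvw i ?_) rfl
  by_contra hE
  exact notMem_vars_of_pderiv_eq_zero (h i hE) hi

section Taylor

variable {K : Type*} [RCLike K] [DecidableEq σ]

lemma hasDerivAt_aeval_update (Z : MvPolynomial σ ℝ) (y : σ → K) (e : σ) (t : K) :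
    HasDerivAt (fun t => aeval (Function.update y e t) Z)
      (aeval (Function.update y e t) (pderiv e Z)) t := by
  induction Z using MvPolynomial.induction_on with
  | C a => simpa using hasDerivAt_const t _
  | add p q hp hq =>
    simp only [map_add]
    exact hp.add hq
  | mul_X p i hp =>
    have hX : HasDerivAt (fun t => Function.update y e t i)
        (aeval (Function.update y e t) (pderiv e (X i : MvPolynomial σ ℝ))) t := by
      rcases eq_or_ne i e with rfl | hi
      · simp only [Function.update_self, pderiv_X_self, map_one]
        exact hasDerivAt_id t
      · simpa [hi, pderiv_X_of_ne hi] using hasDerivAt_const t _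
    simp only [pderiv_mul, map_add, map_mul, aeval_X (R := ℝ) (Function.update y e _) i]
    exact hp.mul hX

/-- A function of one variable with zero derivative is constant. This applies first to the partial
derivative, then to the polynomial minus its linear part. -/
lemma aeval_update_of_pderiv_pderiv_eq_zero {Z : MvPolynomial σ ℝ} {e : σ}
    (h : pderiv e (pderiv e Z) = 0) (y : σ → K) (t : K) :
    aeval (Function.update y e t) Z = aeval y Z + (t - y e) * aeval y (pderiv e Z) := by
  have h1 : ∀ s, aeval (Function.update y e s) (pderiv e Z) = aeval y (pderiv e Z) := by
    intro s
    have := is_const_of_deriv_eq_zero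
      (f := fun s => aeval (Function.update y e s) (pderiv e Z))
      (fun s => (hasDerivAt_aeval_update (pderiv e Z) y e s).differentiableAt)
      (fun s => by rw [(hasDerivAt_aeval_update (pderiv e Z) y e s).deriv, h, map_zero]) s (y e)
    simpa using this
  have h2 : ∀ s, HasDerivAt (fun s => aeval (Function.update y e s) Z
      - s * aeval y (pderiv e Z)) 0 s := by
    intro s
    have := (hasDerivAt_aeval_update Z y e s).sub
      ((hasDerivAt_id s).mul_const (aeval y (pderiv e Z)))
    rw [h1, one_mul, sub_self] at this
    exact this
  have h3 := is_const_of_deriv_eq_zero (fun s => (h2 s).differentiableAt)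
    (fun s => (h2 s).deriv) t (y e)
  simp only [Function.update_eq_self] at h3
  linear_combination h3

lemma IsMultiaffine.aeval_update {Z : MvPolynomial σ ℝ} (h : IsMultiaffine Z) (y : σ → K)
    (e : σ) (t : K) :
    aeval (Function.update y e t) Z = aeval y Z + (t - y e) * aeval y (MvPolynomial.pderiv e Z) :=
  aeval_update_of_pderiv_pderiv_eq_zero (h e) y t

lemma IsMultiaffine.eval_update {Z : MvPolynomial σ ℝ} (h : IsMultiaffine Z) (y : σ → ℝ)
    (e : σ) (t : ℝ) :
    eval (Function.update y e t) Z = eval y Z + (t - y e) * eval y (MvPolynomial.pderiv e Z) := by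
  simpa [coe_aeval_eq_eval] using h.aeval_update y e t

end Taylor

/-- A polynomial inequality that holds off the zero locus of a nonzero polynomial holds
everywhere. -/
lemma eval_nonneg_of_dense {p q : MvPolynomial σ ℝ} {y₀ : σ → ℝ} (hp : eval y₀ p ≠ 0)
    (h : ∀ y, eval y p ≠ 0 → 0 ≤ eval y q) (y : σ → ℝ) : 0 ≤ eval y q := by
  -- Restrict to the line from `y` (at `t = 0`) to `y₀` (at `t = 1`). If `q` is negative at `0`,
  -- then it is negative nearby, so `p` has infinitely many zeros on the line and vanishes at `y₀`
  -- as well.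
  let v : σ → Polynomial ℝ := fun i =>
    Polynomial.C (y i) + Polynomial.X * Polynomial.C (y₀ i - y i)
  have hv : ∀ (r : MvPolynomial σ ℝ) (t : ℝ),
      (aeval v r).eval t = eval (fun i => y i + t * (y₀ i - y i)) r := by
    intro r t
    have : ((Polynomial.aeval t).comp (aeval v)) r
        = aeval (fun i => y i + t * (y₀ i - y i)) r := by
      congr 1
      ext i
      simp [v]
    simpa [coe_aeval_eq_eval, Polynomial.coe_aeval_eq_eval] using this
  by_contra hq
  push Not at hq
  have h0 : (aeval v q).eval 0 < 0 := by simpa [hv] using hq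
  have hc : ∀ᶠ t in nhds (0 : ℝ), (aeval v q).eval t < 0 :=
    (aeval v q).continuous.continuousAt.eventually_lt continuousAt_const h0
  have hz : aeval v p = 0 := by
    refine Polynomial.eq_zero_of_infinite_isRoot _ ?_
    refine (infinite_of_mem_nhds (0 : ℝ) hc).mono fun t ht => ?_
    by_contra hr
    have := h _ (by rw [← hv]; exact hr)
    rw [← hv] at this
    exact absurd ht (not_lt.2 this)
  apply hp
  have := hv p 1
  rw [hz] at this
  simpa using this.symm

end MvPolynomial

/-! ### Rayleigh differences and the symmetry of their discriminants. -/

section Rayleigh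

variable {σ : Type*}

lemma rayleighDiff_comm (Z : MvPolynomial σ ℝ) (e f : σ) :
    rayleighDiff Z e f = rayleighDiff Z f e := by
  unfold rayleighDiff
  rw [pderiv_pderiv_comm e f, mul_comm (pderiv e Z)]

lemma eval_rayleighDiff (Z : MvPolynomial σ ℝ) (e f : σ) (y : σ → ℝ) :
    eval y (rayleighDiff Z e f) = eval y (pderiv e Z) * eval y (pderiv f Z)
      - eval y (pderiv e (pderiv f Z)) * eval y Z := by
  simp [rayleighDiff]

/-- The middle coefficient of `ΔZ{e,f}` as a quadratic polynomial in the variable `g`. -/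
lemma eval_rayleighDiff_update [DecidableEq σ] {Z : MvPolynomial σ ℝ} (hZ : IsMultiaffine Z)
    (e f g : σ) (y : σ → ℝ) (t : ℝ) :
    eval (Function.update y g t) (rayleighDiff Z e f) =
      eval y (rayleighDiff (pderiv g Z) e f) * ((t - y g) * (t - y g))
      + (eval y (pderiv g (pderiv e Z)) * eval y (pderiv f Z)
        + eval y (pderiv g (pderiv f Z)) * eval y (pderiv e Z)
        - eval y (pderiv g (pderiv e (pderiv f Z))) * eval y Z
        - eval y (pderiv e (pderiv f Z)) * eval y (pderiv g Z)) * (t - y g)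
      + eval y (rayleighDiff Z e f) := by
  simp only [eval_rayleighDiff]
  rw [hZ.eval_update, (hZ.pderiv e).eval_update, (hZ.pderiv f).eval_update,
    ((hZ.pderiv f).pderiv e).eval_update, pderiv_pderiv_comm e g, pderiv_pderiv_comm f g,
    pderiv_pderiv_comm e g]
  ring

/-- If `ΔZ{e,f}` is nonnegative, then so is `ΔZ{e,g}`, provided that `ΔZ_f{e,g}` is nonnegative
and not identically zero: the discriminants of `ΔZ{e,f}` in the variable `g` and of `ΔZ{e,g}` in
the variable `f` coincide. -/
theorem rayleighDiff_nonneg_of_contract {Z : MvPolynomial σ ℝ} (hZ : IsMultiaffine Z) {e f g : σ}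
    (hef : ∀ y, 0 ≤ eval y (rayleighDiff Z e f))
    (hfeg : ∀ y, 0 ≤ eval y (rayleighDiff (pderiv f Z) e g))
    {y₀ : σ → ℝ} (h₀ : eval y₀ (rayleighDiff (pderiv f Z) e g) ≠ 0) (y : σ → ℝ) :
    0 ≤ eval y (rayleighDiff Z e g) := by
  classical
  refine eval_nonneg_of_dense h₀ (fun y hy => ?_) y
  have hpos := lt_of_le_of_ne (hfeg y) hy.symm
  have hq := fun u : ℝ => hef (Function.update y g (y g + u))
  simp only [eval_rayleighDiff_update hZ, add_sub_cancel_left] at hq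
  have hd := discrim_le_zero hq
  rw [discrim] at hd
  have key : 0 ≤ eval y (rayleighDiff (pderiv f Z) e g) * eval y (rayleighDiff Z e g) := by
    have h1 := pderiv_pderiv_comm g e Z
    have h2 := pderiv_pderiv_comm g f Z
    have h4 : pderiv g (pderiv e (pderiv f Z)) = pderiv e (pderiv f (pderiv g Z)) := by
      rw [pderiv_pderiv_comm g e, h2]
    -- This is the square of the middle coefficient of `ΔZ{e,g}` in `y_f`. Subtracting the common
    -- discriminant, which is at most zero by `hd`, leaves four times the product in `key`.
    have hsq := sq_nonneg (eval y (pderiv e (pderiv f Z)) * eval y (pderiv g Z)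
        + eval y (pderiv f (pderiv g Z)) * eval y (pderiv e Z)
        - eval y (pderiv e (pderiv f (pderiv g Z))) * eval y Z
        - eval y (pderiv e (pderiv g Z)) * eval y (pderiv f Z))
    simp only [eval_rayleighDiff, h1, h2, h4] at hd ⊢
    linarith
  exact nonneg_of_mul_nonneg_right key hpos

end Rayleigh

/-! ### Reduction to one pair, and stability of strongly Rayleigh polynomials. -/

section Stability

variable {σ : Type*}

lemma eval_rayleighDiff_eq_zero_of_pderiv_left {Z : MvPolynomial σ ℝ} {e : σ} (h : pderiv e Z = 0)
    (f : σ) (y : σ → ℝ) : eval y (rayleighDiff Z e f) = 0 := by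
  simp [eval_rayleighDiff, pderiv_pderiv_comm e f, h]

/-- Extends the strong Rayleigh property from `E.erase e` to `E` for a contraction by `e`. -/
lemma IsStronglyRayleigh.of_erase {E : Finset σ} {Z : MvPolynomial σ ℝ} {e : σ}
    (h : IsStronglyRayleigh ((E : Set σ) \ {e}) Z) (he : MvPolynomial.pderiv e Z = 0) :
    IsStronglyRayleigh (E : Set σ) Z := by
  intro y g hg k hk hgk
  rcases eq_or_ne g e with rfl | hge
  · rw [eval_rayleighDiff_eq_zero_of_pderiv_left he]
  rcases eq_or_ne k e with rfl | hke
  · rw [rayleighDiff_comm, eval_rayleighDiff_eq_zero_of_pderiv_left he]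
  exact h y g (by simpa [hge] using hg) k (by simpa [hke] using hk) hgk

/-- One nonnegative Rayleigh difference `ΔZ{e,f}` suffices for the strong Rayleigh property of
`Z` if the contractions `Z_e` and `Z_f` are strongly Rayleigh with nontrivial Rayleigh
differences. -/
theorem IsStronglyRayleigh.of_pair {E : Set σ} {Z : MvPolynomial σ ℝ} (hZ : IsMultiaffine Z)
    {e f : σ} (hf : f ∈ E) (he : e ∈ E) (hne : e ≠ f)
    (hef : ∀ y, 0 ≤ eval y (rayleighDiff Z e f))
    (hSe : IsStronglyRayleigh E (pderiv e Z)) (hSf : IsStronglyRayleigh E (pderiv f Z))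
    (hNe : ∀ g ∈ E, ∀ h ∈ E, g ≠ e → h ≠ e → g ≠ h →
      ∃ y, eval y (rayleighDiff (pderiv e Z) g h) ≠ 0)
    (hNf : ∀ g ∈ E, g ≠ e → g ≠ f → ∃ y, eval y (rayleighDiff (pderiv f Z) e g) ≠ 0) :
    IsStronglyRayleigh E Z := by
  have h1 : ∀ g ∈ E, g ≠ e → ∀ y, 0 ≤ eval y (rayleighDiff Z e g) := by
    intro g hg hge
    rcases eq_or_ne g f with rfl | hgf
    · exact hef
    · obtain ⟨y₀, h₀⟩ := hNf g hg hge hgf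
      exact rayleighDiff_nonneg_of_contract hZ hef (fun y => hSf y e he g hg hge.symm) h₀
  intro y g hg h hh hgh
  rcases eq_or_ne g e with rfl | hge
  · exact h1 h hh hgh.symm y
  rcases eq_or_ne h e with rfl | hhe
  · rw [rayleighDiff_comm]
    exact h1 g hg hge y
  obtain ⟨y₀, h₀⟩ := hNe g hg h hh hge hhe hgh
  -- From the pair `{g,e}` to `{g,h}`, now contracting `e`. The pairs containing `e` came from
  -- `{e,f}` by contracting `f`.
  refine rayleighDiff_nonneg_of_contract (f := e) hZ (fun y => ?_)
    (fun y => hSe y g hg h hh hgh) h₀ y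
  rw [rayleighDiff_comm]
  exact h1 g hg hge y

lemma nonneg_of_forall_quadratic_nonneg {a b c : ℝ} (h : ∀ t : ℝ, 0 ≤ a * (t * t) + b * t + c) :
    0 ≤ a := by
  by_contra ha
  push Not at ha
  have hd := discrim_le_zero h
  rw [discrim] at hd
  have hc := h 0
  have h1 := h 1
  have h2 := h (-1)
  -- Values at opposite points cancel the linear term, and the point is large enough that `-a * t ^
  -- 2` exceeds `c`.
  have h3 := h ((c + 1) / -a + 1)
  have h4 := h (-((c + 1) / -a + 1))
  have hx : (c + 1) / -a * -a = c + 1 := div_mul_cancel₀ _ (by linarith)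
  have hx0 : 0 < (c + 1) / -a := div_pos (by linarith) (by linarith)
  nlinarith

/-- The Rayleigh difference of the derivative is the leading coefficient, in `y_e`, of a quadratic
that is nonnegative everywhere. -/
lemma IsStronglyRayleigh.pderiv {Z : MvPolynomial σ ℝ} (hZ : IsMultiaffine Z)
    (h : IsStronglyRayleigh Set.univ Z) (e : σ) :
    IsStronglyRayleigh Set.univ (MvPolynomial.pderiv e Z) := by
  classical
  intro y g _ k _ hgk
  have := fun t => h (Function.update y e (y e + t)) g trivial k trivial hgk
  simp only [eval_rayleighDiff_update hZ, add_sub_cancel_left] at this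
  exact nonneg_of_forall_quadratic_nonneg this

/-- The specialization of the variable `e` of the multiaffine polynomial `Z` to `t`. -/
noncomputable def MvPolynomial.specialize (Z : MvPolynomial σ ℝ) (e : σ) (t : ℝ) :
    MvPolynomial σ ℝ :=
  Z + (C t - X e) * pderiv e Z

lemma pderiv_specialize_self {Z : MvPolynomial σ ℝ} (hZ : IsMultiaffine Z) (e : σ) (t : ℝ) :
    pderiv e (specialize Z e t) = 0 := by
  simp [specialize, hZ e]

lemma pderiv_specialize_of_ne (Z : MvPolynomial σ ℝ) {e g : σ} (h : g ≠ e) (t : ℝ) :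
    pderiv g (specialize Z e t) = specialize (pderiv g Z) e t := by
  simp [specialize, pderiv_X_of_ne h.symm, pderiv_pderiv_comm g e]

lemma aeval_specialize {K : Type*} [CommRing K] [Algebra ℝ K] (Z : MvPolynomial σ ℝ) (e : σ)
    (t : ℝ) (y : σ → K) : aeval y (specialize Z e t)
      = aeval y Z + (algebraMap ℝ K t - y e) * aeval y (pderiv e Z) := by
  simp [specialize, algHom_C]

lemma eval_specialize [DecidableEq σ] {Z : MvPolynomial σ ℝ} (hZ : IsMultiaffine Z) (e : σ)
    (t : ℝ) (y : σ → ℝ) : eval y (specialize Z e t) = eval (Function.update y e t) Z := by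
  rw [hZ.eval_update]
  simp [specialize]

lemma MvPolynomial.IsMultiaffine.specialize {Z : MvPolynomial σ ℝ} (hZ : IsMultiaffine Z)
    (e : σ) (t : ℝ) : IsMultiaffine (specialize Z e t) := by
  intro g
  rcases eq_or_ne g e with rfl | h
  · rw [pderiv_specialize_self hZ, map_zero]
  · rw [pderiv_specialize_of_ne _ h, pderiv_specialize_of_ne _ h, hZ g]
    simp [MvPolynomial.specialize]

/-- Away from `e`, differentiation commutes with specialization, so the Rayleigh difference is that
of `Z` at `y_e = t`. Pairs containing `e` give zero. -/
lemma IsStronglyRayleigh.specialize {Z : MvPolynomial σ ℝ} (hZ : IsMultiaffine Z)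
    (h : IsStronglyRayleigh Set.univ Z) (e : σ) (t : ℝ) :
    IsStronglyRayleigh Set.univ (specialize Z e t) := by
  classical
  intro y g _ k _ hgk
  rcases eq_or_ne g e with rfl | hge
  · rw [eval_rayleighDiff_eq_zero_of_pderiv_left (pderiv_specialize_self hZ _ t)]
  rcases eq_or_ne k e with rfl | hke
  · rw [rayleighDiff_comm, eval_rayleighDiff_eq_zero_of_pderiv_left (pderiv_specialize_self hZ _ t)]
  have := h (Function.update y e t) g trivial k trivial hgk
  rw [eval_rayleighDiff] at this ⊢
  rw [pderiv_specialize_of_ne _ hge, pderiv_specialize_of_ne _ hke, pderiv_specialize_of_ne _ hge,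
    eval_specialize hZ, eval_specialize (hZ.pderiv _), eval_specialize (hZ.pderiv _),
    eval_specialize ((hZ.pderiv _).pderiv _)]
  exact this

/-- A ratio of multiaffine polynomials whose logarithmic derivatives agree is constant on a
product of upper half planes on which the denominator does not vanish. -/
lemma aeval_mul_aeval_eq_of_wronskian_eq_zero {E : Finset σ} {P D : MvPolynomial σ ℝ}
    (hP : IsMultiaffine P) (hD : IsMultiaffine D)
    (hPE : ∀ i ∉ E, pderiv i P = 0) (hDE : ∀ i ∉ E, pderiv i D = 0)
    (hW : ∀ i ∈ E, pderiv i P * D = P * pderiv i D)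
    (hD0 : ∀ w : σ → ℂ, (∀ i ∈ E, 0 < (w i).im) → aeval w D ≠ 0) {v w : σ → ℂ}
    (hv : ∀ i ∈ E, 0 < (v i).im) (hw : ∀ i ∈ E, 0 < (w i).im) :
    aeval v P * aeval w D = aeval w P * aeval v D := by
  classical
  -- Move from `w` to `v` one coordinate at a time. All intermediate points stay in the half planes,
  -- so `D` can be cancelled there.
  have key : ∀ T ⊆ E, aeval (T.piecewise v w) P * aeval w D
      = aeval w P * aeval (T.piecewise v w) D := by
    intro T
    induction T using Finset.induction_on with
    | empty => simp
    | insert i T hi ih =>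
      intro hT
      have hTE := (subset_insert i T).trans hT
      have h0 := ih hTE
      have hne : aeval (T.piecewise v w) D ≠ 0 := hD0 _ fun j hj => by
        by_cases hjT : j ∈ T
        · simpa [hjT] using hv j hj
        · simpa [hjT] using hw j hj
      have hWi := congrArg (aeval (T.piecewise v w)) (hW i (hT (mem_insert_self i T)))
      rw [map_mul, map_mul] at hWi
      rw [piecewise_insert, hP.aeval_update, hD.aeval_update]
      have : aeval w D * aeval (T.piecewise v w) (pderiv i P)
          = aeval w P * aeval (T.piecewise v w) (pderiv i D) := by
        refine mul_right_cancel₀ hne ?_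
        linear_combination (aeval w D) * hWi + aeval (T.piecewise v w) (pderiv i D) * h0
      linear_combination h0 + (v i - T.piecewise v w i) * this
  have h1 := key E subset_rfl
  have h2 : ∀ i ∈ E, E.piecewise v w i = v i := fun i hi => by simp [hi]
  rwa [aeval_congr_of_pderiv_eq_zero hPE h2, aeval_congr_of_pderiv_eq_zero hDE h2] at h1

lemma ofReal_eval (x : σ → ℝ) (P : MvPolynomial σ ℝ) :
    aeval (fun i => (x i : ℂ)) P = (eval x P : ℂ) := by
  have := aeval_algebraMap_apply ℂ x P
  rw [← coe_aeval_eq_eval]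
  exact this

/-- A nonzero strongly Rayleigh multiaffine polynomial does not vanish if all variables are in
the upper half plane. -/
theorem IsStronglyRayleigh.aeval_ne_zero (E : Finset σ) : ∀ Z : MvPolynomial σ ℝ, Z ≠ 0 →
    (∀ i ∉ E, MvPolynomial.pderiv i Z = 0) → IsMultiaffine Z → IsStronglyRayleigh Set.univ Z →
    ∀ w : σ → ℂ, (∀ i ∈ E, 0 < (w i).im) → aeval w Z ≠ 0 := by
  classical
  induction E using Finset.induction_on with
  | empty =>
    intro Z hZ0 hZE _ _ w _
    have hvars : Z.vars = ∅ := eq_empty_of_forall_notMem fun i =>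
      notMem_vars_of_pderiv_eq_zero (hZE i (notMem_empty i))
    obtain ⟨r, rfl⟩ := (⟨_, vars_eq_empty_iff_eq_C.1 hvars⟩ : ∃ r, Z = C r)
    have hr : r ≠ 0 := by
      rintro rfl
      simp at hZ0
    simpa [algHom_C] using hr
  | insert e E heE ih =>
    intro Z hZ0 hZE hZ hS w hw hwZ
    have hwE : ∀ i ∈ E, 0 < (w i).im := fun i hi => hw i (mem_insert_of_mem hi)
    by_cases hD0 : MvPolynomial.pderiv e Z = 0
    · refine ih Z hZ0 (fun i hi => ?_) hZ hS w hwE hwZ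
      rcases eq_or_ne i e with rfl | hie
      · exact hD0
      · exact hZE i (by simp [hie, hi])
    have hDE : ∀ i ∉ E, MvPolynomial.pderiv i (MvPolynomial.pderiv e Z) = 0 := by
      intro i hi
      rcases eq_or_ne i e with rfl | hie
      · exact hZ i
      · rw [pderiv_pderiv_comm, hZE i (by simp [hie, hi]), map_zero]
    have hDw := ih _ hD0 hDE (hZ.pderiv e) (hS.pderiv hZ e)
    have hWE : ∀ t, ∀ i ∉ E, MvPolynomial.pderiv i (MvPolynomial.specialize Z e t) = 0 := by
      intro t i hi
      rcases eq_or_ne i e with rfl | hie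
      · exact pderiv_specialize_self hZ i t
      · rw [pderiv_specialize_of_ne _ hie, hZE i (by simp [hie, hi])]
        simp [MvPolynomial.specialize]
    have hWt : ∀ (t : ℝ) (v : σ → ℂ), aeval v (MvPolynomial.specialize Z e t)
        = aeval v (MvPolynomial.specialize Z e 0) + t * aeval v (MvPolynomial.pderiv e Z) := by
      intro t v
      simp only [aeval_specialize, map_zero, Complex.coe_algebraMap]
      ring
    have hwD := hDw w hwE
    have hwe := hw e (mem_insert_self e E)
    -- Otherwise `(t - w e) * D(w) = 0`, with `D` the derivative in `e`; as `D(w) ≠ 0`, this would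
    -- make `w e` real.
    have hW0 : ∀ t, MvPolynomial.specialize Z e t ≠ 0 := by
      intro t ht
      have h1 := aeval_specialize Z e t w
      rw [ht, hwZ, map_zero, zero_add, eq_comm, mul_eq_zero, or_iff_left hwD] at h1
      have := congrArg Complex.im h1
      simp at this
      linarith
    have hWv : ∀ t (v : σ → ℂ), (∀ i ∈ E, 0 < (v i).im) →
        aeval v (MvPolynomial.specialize Z e t) ≠ 0 := fun t =>
      ih _ (hW0 t) (hWE t) (hZ.specialize e t) (hS.specialize hZ e t)
    have hPw : aeval w (MvPolynomial.specialize Z e 0)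
        = -(w e * aeval w (MvPolynomial.pderiv e Z)) := by
      rw [aeval_specialize, hwZ]
      simp
    have hray : ∀ j, j ≠ e → ∀ x, eval x (rayleighDiff Z e j) =
        eval x (MvPolynomial.pderiv j (MvPolynomial.specialize Z e 0))
            * eval x (MvPolynomial.pderiv e Z)
          - eval x (MvPolynomial.specialize Z e 0)
            * eval x (MvPolynomial.pderiv j (MvPolynomial.pderiv e Z)) := by
      intro j hj x
      rw [eval_rayleighDiff, pderiv_specialize_of_ne _ hj, pderiv_pderiv_comm j e]
      simp only [MvPolynomial.specialize, map_add, map_mul, map_sub, eval_C, eval_X]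
      ring
    set P := MvPolynomial.specialize Z e 0 with hPdef
    set D := MvPolynomial.pderiv e Z with hDdef
    -- the imaginary part of `P / D` has constant sign
    let ψ : (σ → ℂ) → ℝ := fun v => (aeval v P * (starRingEnd ℂ) (aeval v D)).im
    have hcont : ∀ Q : MvPolynomial σ ℝ, Continuous fun v : σ → ℂ => aeval v Q := fun Q => by
      simpa only [aeval_def, eval₂_eq_eval_map] using
        MvPolynomial.continuous_eval (Q.map (algebraMap ℝ ℂ))
    have hψc : Continuous ψ := by
      exact Complex.continuous_im.comp ((hcont P).mul (Complex.continuous_conj.comp (hcont D)))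
    let S : Set (σ → ℂ) := {v | ∀ i ∈ E, 0 < (v i).im}
    have hSconv : Convex ℝ S := by
      intro a ha b hb s t hs ht hst i hi
      have h1 := ha i hi
      have h2 := hb i hi
      simp only [Pi.add_apply, Pi.smul_apply, Complex.add_im, Complex.smul_im, smul_eq_mul]
      rcases hs.eq_or_lt with rfl | hs
      · have : t = 1 := by linarith
        subst this
        linarith
      · nlinarith [mul_pos hs h1, mul_nonneg ht h2.le]
    -- If `ψ v = 0`, then `P / D` is real at `v`, and the specialization at `t = -P / D` vanishes
    -- there, against the induction hypothesis.
    have hψ0 : ∀ v ∈ S, ψ v ≠ 0 := by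
      intro v hv h
      have hDv := hDw v hv
      have hn : (Complex.normSq (aeval v D) : ℂ) ≠ 0 := by
        exact_mod_cast (Complex.normSq_pos.2 hDv).ne'
      have hreal : aeval v P * (starRingEnd ℂ) (aeval v D)
          = ((aeval v P * (starRingEnd ℂ) (aeval v D)).re : ℂ) := by
        refine Complex.ext ?_ ?_
        · simp only [Complex.ofReal_re]
        · simpa only [Complex.ofReal_im] using h
      set r := (aeval v P * (starRingEnd ℂ) (aeval v D)).re
      refine hWv (-(r / Complex.normSq (aeval v D))) v hv ?_
      rw [hWt]
      have hc : (starRingEnd ℂ) (aeval v D) * aeval v D = Complex.normSq (aeval v D) :=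
        Complex.normSq_eq_conj_mul_self.symm
      push_cast
      field_simp
      linear_combination (aeval v D) * hreal - (aeval v P) * hc
    -- At the supposed zero, `P / D = -w e` has negative imaginary part; connectedness of `S` then
    -- spreads the sign.
    have hψw : ψ w < 0 := by
      have h2 : ψ w = -((w e).im * Complex.normSq (aeval w D)) := by
        simp only [ψ, hPw, neg_mul, mul_assoc, Complex.mul_conj, Complex.neg_im,
          Complex.im_mul_ofReal]
      rw [h2]
      exact neg_neg_of_pos (mul_pos hwe (Complex.normSq_pos.2 hwD))
    have hψS : ∀ v ∈ S, ψ v < 0 := by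
      intro v hv
      by_contra hcon
      push Not at hcon
      obtain ⟨u, hu, hu0⟩ := hSconv.isPreconnected.intermediate_value hwE hv
        hψc.continuousOn ⟨hψw.le, hcon⟩
      exact hψ0 u hu hu0
    have hPaff : IsMultiaffine P := hZ.specialize e 0
    have hDaff : IsMultiaffine D := hZ.pderiv e
    have hcl : ∀ x : σ → ℂ, (∀ i, 0 ≤ (x i).im) → x ∈ closure S := by
      intro x hx
      have ht : Filter.Tendsto (fun (s : ℝ) i => x i + s * Complex.I) (nhdsWithin 0 (Set.Ioi 0))
          (nhds x) := by
        refine (Continuous.tendsto' ?_ 0 x ?_).mono_left nhdsWithin_le_nhds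
        · fun_prop
        · ext i
          simp
      refine mem_closure_of_tendsto ht ?_
      filter_upwards [self_mem_nhdsWithin] with s hs i _
      have hs' : 0 < s := hs
      have := hx i
      simp
      linarith
    -- If all Wronskians vanish, `P / D` is constant. A real point in the closure of `S` shows that
    -- the constant is real, so a real specialization vanishes at `w`.
    by_cases hall : ∀ j ∈ E, MvPolynomial.pderiv j P * D = P * MvPolynomial.pderiv j D
    · obtain ⟨x, hx⟩ : ∃ x : σ → ℝ, eval x D ≠ 0 := by
        by_contra hcon
        push Not at hcon
        exact hD0 (MvPolynomial.funext fun x => by simpa using hcon x)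
      have hmem := closure_minimal (s := S) (t := {v | aeval v P * aeval w D
          = aeval w P * aeval v D})
        (fun v hv =>
          aeval_mul_aeval_eq_of_wronskian_eq_zero hPaff hDaff (hWE 0) hDE hall hDw hv hwE)
        (isClosed_eq ((hcont P).mul continuous_const) (continuous_const.mul (hcont D)))
        (hcl (fun i => (x i : ℂ)) fun i => by simp)
      simp only [Set.mem_ofPred_eq, ofReal_eval] at hmem
      refine hWv (-(eval x P / eval x D)) w hwE ?_
      rw [hWt]
      have hx' : (eval x D : ℂ) ≠ 0 := by exact_mod_cast hx
      push_cast
      field_simp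
      linear_combination -hmem
    · push Not at hall
      obtain ⟨j, hjE, hj⟩ := hall
      have hje : j ≠ e := by
        rintro rfl
        exact heE hjE
      obtain ⟨x, hx⟩ : ∃ x : σ → ℝ, eval x (rayleighDiff Z e j) ≠ 0 := by
        by_contra hcon
        push Not at hcon
        refine hj (MvPolynomial.funext fun x => ?_)
        have := hcon x
        rw [hray j hje] at this
        simpa [sub_eq_zero] using this
      have hpos := lt_of_le_of_ne (hS x e trivial j trivial hje.symm) hx.symm
      rw [hray j hje] at hpos
      -- At the boundary point `x` with `i` added to its `j`th coordinate, `ψ` equals `P_j D - P D_j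
      -- = ΔZ{e,j}(x) > 0`, contradicting `ψ ≤ 0` on the closure.
      have hmem := closure_minimal (s := S) (t := {v | ψ v ≤ 0}) (fun v hv => (hψS v hv).le)
        (isClosed_le hψc continuous_const)
        (hcl (Function.update (fun i => (x i : ℂ)) j (x j + Complex.I)) fun i => by
          rcases eq_or_ne i j with rfl | hij
          · simp
          · simp [hij])
      simp only [Set.mem_ofPred_eq, ψ, hPaff.aeval_update, hDaff.aeval_update, ofReal_eval,
        add_sub_cancel_left, map_add, map_mul, Complex.conj_ofReal, Complex.conj_I] at hmem
      simp at hmem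
      linarith

end Stability

/-! ### Generating polynomials of set families, deletion and contraction. -/

section SetPoly

variable {σ : Type*}

/-- The generating polynomial of a finite family of finite sets. -/
noncomputable def setPoly (𝓑 : Finset (Finset σ)) : MvPolynomial σ ℝ := ∑ B ∈ 𝓑, ∏ i ∈ B, X i

lemma eval_setPoly (𝓑 : Finset (Finset σ)) (y : σ → ℝ) :
    eval y (setPoly 𝓑) = ∑ B ∈ 𝓑, ∏ i ∈ B, y i := by
  simp [setPoly]

lemma eval_one_setPoly (𝓑 : Finset (Finset σ)) : eval 1 (setPoly 𝓑) = #𝓑 := by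
  simp [eval_setPoly]

lemma setPoly_ne_zero {𝓑 : Finset (Finset σ)} (h : 𝓑.Nonempty) : setPoly 𝓑 ≠ 0 := by
  intro h0
  have := eval_one_setPoly 𝓑
  rw [h0, map_zero] at this
  exact h.card_ne_zero (by exact_mod_cast this.symm)

lemma IsStronglyRayleigh.univ_of_pderiv_eq_zero {E : Set σ} {Z : MvPolynomial σ ℝ}
    (h : IsStronglyRayleigh E Z) (hE : ∀ i ∉ E, MvPolynomial.pderiv i Z = 0) :
    IsStronglyRayleigh Set.univ Z := by
  intro y e _ f _ hef
  by_cases he : e ∈ E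
  · by_cases hf : f ∈ E
    · exact h y e he f hf hef
    · rw [rayleighDiff_comm, eval_rayleighDiff_eq_zero_of_pderiv_left (hE f hf)]
  · rw [eval_rayleighDiff_eq_zero_of_pderiv_left (hE e he)]

variable [DecidableEq σ]

/-- The contraction of a family of sets: its members containing `e`, with `e` removed. -/
def contractFamily (𝓑 : Finset (Finset σ)) (e : σ) : Finset (Finset σ) :=
  (𝓑.filter (e ∈ ·)).image (·.erase e)

/-- The deletion of a family of sets: its members not containing `e`. -/
def deleteFamily (𝓑 : Finset (Finset σ)) (e : σ) : Finset (Finset σ) := 𝓑.filter (e ∉ ·)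

lemma setPoly_eq_delete_add_contract (𝓑 : Finset (Finset σ)) (e : σ) :
    setPoly 𝓑 = setPoly (deleteFamily 𝓑 e) + X e * setPoly (contractFamily 𝓑 e) := by
  unfold setPoly deleteFamily contractFamily
  rw [sum_image, mul_sum, ← sum_filter_add_sum_filter_not 𝓑 (e ∈ ·), add_comm]
  · congr 1
    refine sum_congr rfl fun B hB => ?_
    rw [mul_prod_erase _ _ (mem_filter.1 hB).2]
  · intro B hB C hC h
    have hB' := (mem_filter.1 hB).2
    have hC' := (mem_filter.1 hC).2
    rw [← insert_erase hB', ← insert_erase hC']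
    exact congrArg (insert e) h

lemma pderiv_setPoly_of_notMem {𝓑 : Finset (Finset σ)} {e : σ} (h : ∀ B ∈ 𝓑, e ∉ B) :
    pderiv e (setPoly 𝓑) = 0 := by
  unfold setPoly
  rw [map_sum]
  refine sum_eq_zero fun B hB' => ?_
  have hB := h B hB'
  clear hB'
  induction B using Finset.induction_on with
  | empty => simp
  | insert i B hi ih =>
    rw [mem_insert, not_or] at hB
    rw [prod_insert hi, pderiv_mul, ih hB.2, pderiv_X_of_ne (Ne.symm hB.1)]
    simp

lemma notMem_of_mem_contractFamily {𝓑 : Finset (Finset σ)} {e : σ} :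
    ∀ B ∈ contractFamily 𝓑 e, e ∉ B := by
  intro B hB
  obtain ⟨C, -, rfl⟩ := mem_image.1 hB
  exact notMem_erase e C

lemma notMem_of_mem_deleteFamily {𝓑 : Finset (Finset σ)} {e : σ} :
    ∀ B ∈ deleteFamily 𝓑 e, e ∉ B := fun _ hB => (mem_filter.1 hB).2

lemma notMem_contractFamily {𝓑 : Finset (Finset σ)} {e f : σ} (h : ∀ B ∈ 𝓑, f ∉ B) :
    ∀ B ∈ contractFamily 𝓑 e, f ∉ B := by
  intro B hB
  obtain ⟨C, hC, rfl⟩ := mem_image.1 hB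
  exact fun hf => h C (mem_filter.1 hC).1 (mem_of_mem_erase hf)

lemma notMem_deleteFamily {𝓑 : Finset (Finset σ)} {e f : σ} (h : ∀ B ∈ 𝓑, f ∉ B) :
    ∀ B ∈ deleteFamily 𝓑 e, f ∉ B := fun B hB => h B (mem_filter.1 hB).1

lemma pderiv_setPoly (𝓑 : Finset (Finset σ)) (e : σ) :
    pderiv e (setPoly 𝓑) = setPoly (contractFamily 𝓑 e) := by
  rw [setPoly_eq_delete_add_contract 𝓑 e, map_add, pderiv_mul,
    pderiv_setPoly_of_notMem notMem_of_mem_deleteFamily,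
    pderiv_setPoly_of_notMem notMem_of_mem_contractFamily]
  simp

lemma isMultiaffine_setPoly (𝓑 : Finset (Finset σ)) : IsMultiaffine (setPoly 𝓑) := fun e => by
  rw [pderiv_setPoly, pderiv_setPoly_of_notMem notMem_of_mem_contractFamily]

/-- The Rayleigh difference in terms of the deletions and contractions of `e` and `f`. -/
lemma eval_rayleighDiff_setPoly (𝓑 : Finset (Finset σ)) {e f : σ} (hef : e ≠ f) (y : σ → ℝ) :
    eval y (rayleighDiff (setPoly 𝓑) e f) =
      eval y (setPoly (contractFamily (deleteFamily 𝓑 f) e))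
          * eval y (setPoly (deleteFamily (contractFamily 𝓑 f) e))
        - eval y (setPoly (contractFamily (contractFamily 𝓑 f) e))
          * eval y (setPoly (deleteFamily (deleteFamily 𝓑 f) e)) := by
  rw [eval_rayleighDiff, setPoly_eq_delete_add_contract 𝓑 f,
    setPoly_eq_delete_add_contract (deleteFamily 𝓑 f) e,
    setPoly_eq_delete_add_contract (contractFamily 𝓑 f) e]
  have hd : ∀ B ∈ deleteFamily 𝓑 f, f ∉ B := notMem_of_mem_deleteFamily
  have hc : ∀ B ∈ contractFamily 𝓑 f, f ∉ B := notMem_of_mem_contractFamily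
  simp only [map_add, pderiv_mul, pderiv_X_self, pderiv_X_of_ne hef, pderiv_X_of_ne hef.symm,
    pderiv_setPoly_of_notMem (notMem_of_mem_deleteFamily (e := e)),
    pderiv_setPoly_of_notMem (notMem_of_mem_contractFamily (e := e)),
    pderiv_setPoly_of_notMem (notMem_deleteFamily (e := e) hd),
    pderiv_setPoly_of_notMem (notMem_deleteFamily (e := e) hc),
    pderiv_setPoly_of_notMem (notMem_contractFamily (e := e) hd),
    pderiv_setPoly_of_notMem (notMem_contractFamily (e := e) hc), map_mul, eval_X, map_zero,
    map_one, pderiv_one]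
  ring

lemma eval_setPoly_toFinset (l : List (List σ)) (hl : (l.map List.toFinset).Nodup)
    (hl' : ∀ a ∈ l, a.Nodup) (y : σ → ℝ) :
    eval y (setPoly (l.map List.toFinset).toFinset) = (l.map fun a => (a.map y).prod).sum := by
  rw [eval_setPoly, List.sum_toFinset _ hl, List.map_map]
  congr 1
  refine List.map_congr_left fun a ha => ?_
  simp [List.prod_toFinset _ (hl' a ha)]

/-- At the all-ones point every generating polynomial counts its family, so nonvanishing becomes a
decidable statement about cardinalities. -/
lemma exists_eval_rayleighDiff_setPoly_ne_zero {𝓑 : Finset (Finset σ)} {e f : σ}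
    (h : #(contractFamily 𝓑 e) * #(contractFamily 𝓑 f) ≠
      #(contractFamily (contractFamily 𝓑 f) e) * #𝓑) :
    ∃ y, eval y (rayleighDiff (setPoly 𝓑) e f) ≠ 0 := by
  refine ⟨1, ?_⟩
  rw [eval_rayleighDiff, pderiv_setPoly, pderiv_setPoly, pderiv_setPoly]
  simp only [eval_one_setPoly]
  rw [sub_ne_zero]
  exact_mod_cast h

/-- A homogeneous multiaffine polynomial that is strongly Rayleigh has the half-plane property. -/
theorem IsStronglyRayleigh.hasHalfPlaneProperty {E : Finset σ} {r : ℕ} {𝓑 : Finset (Finset σ)}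
    (h𝓑 : 𝓑.Nonempty) (hE : 𝓑 ⊆ powersetCard r E)
    (h : IsStronglyRayleigh (E : Set σ) (setPoly 𝓑)) :
    HasHalfPlaneProperty (E : Set σ) (setPoly 𝓑) := by
  have hder : ∀ i ∉ E, MvPolynomial.pderiv i (setPoly 𝓑) = 0 := fun i hi =>
    pderiv_setPoly_of_notMem fun B hB hiB => hi ((mem_powersetCard.1 (hE hB)).1 hiB)
  intro y hy h0
  refine IsStronglyRayleigh.aeval_ne_zero E (setPoly 𝓑) (setPoly_ne_zero h𝓑) hder
    (isMultiaffine_setPoly 𝓑) (h.univ_of_pderiv_eq_zero (by simpa using hder))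
    (fun i => Complex.I * y i) (fun i hi => by simpa using hy i hi) ?_
  -- Multiplication by `I` carries the right half plane to the upper one; homogeneity turns it into
  -- a nonzero scalar factor.
  have : aeval (fun i => Complex.I * y i) (setPoly 𝓑) = Complex.I ^ r * aeval y (setPoly 𝓑) := by
    simp only [setPoly, map_sum, map_prod, aeval_X, mul_sum]
    refine sum_congr rfl fun B hB => ?_
    rw [prod_mul_distrib, prod_const, (mem_powersetCard.1 (hE hB)).2]
  rw [this, h0, mul_zero]

end SetPoly

/-! ### Rank-two matroids. -/

section RankTwo

variable {σ κ : Type*} [DecidableEq σ] [DecidableEq κ]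

/-- A loopless rank-two matroid, given by its parallel classes, is strongly Rayleigh. -/
theorem isStronglyRayleigh_of_rank_two {E : Finset σ} {𝓒 : Finset (Finset σ)}
    (hE : 𝓒 ⊆ powersetCard 2 E) (c : σ → κ)
    (h : ∀ i ∈ E, contractFamily 𝓒 i = (E.filter (c · ≠ c i)).image singleton) :
    IsStronglyRayleigh (E : Set σ) (setPoly 𝓒) := by
  intro y e he f hf hef
  rw [mem_coe] at he hf
  have hlin : ∀ i ∈ E, pderiv i (setPoly 𝓒) = ∑ j ∈ E with c j ≠ c i, X j := by
    intro i hi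
    rw [pderiv_setPoly, h i hi, setPoly, sum_image (by simp)]
    simp
  -- the class sums
  set s : κ → ℝ := fun k => ∑ j ∈ E with c j = k, y j with hs
  set S : ℝ := ∑ j ∈ E, y j with hS
  have hev : ∀ i ∈ E, eval y (pderiv i (setPoly 𝓒)) = S - s (c i) := by
    intro i hi
    rw [hlin i hi, map_sum, hS, ← sum_filter_add_sum_filter_not E (fun j => c j = c i)]
    simp [hs]
  -- Euler's identity in degree two: each basis is counted once for each of its two elements.
  have heuler : 2 * eval y (setPoly 𝓒) = ∑ i ∈ E, y i * (S - s (c i)) := by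
    have h1 : ∀ i ∈ E, y i * (S - s (c i))
        = ∑ B ∈ 𝓒, if i ∈ B then ∏ j ∈ B, y j else 0 := by
      intro i hi
      rw [← hev i hi, pderiv_setPoly, eval_setPoly, ← sum_filter, mul_sum, contractFamily,
        sum_image]
      · refine sum_congr rfl fun B hB => ?_
        rw [mul_prod_erase _ _ (mem_filter.1 hB).2]
      · intro B hB C hC hBC
        rw [← insert_erase (mem_filter.1 hB).2, ← insert_erase (mem_filter.1 hC).2]
        exact congrArg (insert i) hBC
    rw [sum_congr rfl h1, sum_comm, eval_setPoly, mul_sum]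
    refine sum_congr rfl fun B hB => ?_
    have hB := mem_powersetCard.1 (hE hB)
    rw [← sum_filter, sum_const, filter_mem_eq_inter, inter_eq_right.2 hB.1, hB.2]
    simp
  have hfib : ∑ i ∈ E, y i * s (c i) = ∑ k ∈ E.image c, s k ^ 2 := by
    rw [← sum_fiberwise_of_maps_to (fun i hi => mem_image_of_mem c hi)]
    refine sum_congr rfl fun k _ => ?_
    rw [pow_two]
    nth_rewrite 2 [hs]
    rw [sum_mul]
    refine sum_congr rfl fun i hi => ?_
    rw [(mem_filter.1 hi).2]
  have heuler' : 2 * eval y (setPoly 𝓒) = S ^ 2 - ∑ k ∈ E.image c, s k ^ 2 := by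
    rw [heuler, ← hfib, hS, pow_two, sum_mul, ← sum_sub_distrib]
    exact sum_congr rfl fun i _ => mul_sub ..
  rw [eval_rayleighDiff, hev e he, hev f hf, hlin f hf]
  by_cases hc : c e = c f
  · have h0 : eval y (pderiv e (∑ j ∈ E with c j ≠ c f, (X j : MvPolynomial σ ℝ))) = 0 := by
      rw [map_sum, sum_eq_zero, map_zero]
      intro j hj
      rw [pderiv_X_of_ne]
      rintro rfl
      exact (mem_filter.1 hj).2 hc
    rw [h0, hc]
    nlinarith [sq_nonneg (S - s (c f))]
  · have h1 : eval y (pderiv e (∑ j ∈ E with c j ≠ c f, (X j : MvPolynomial σ ℝ))) = 1 := by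
      rw [map_sum, sum_eq_single e]
      · simp
      · intro j _ hj
        exact pderiv_X_of_ne hj
      · intro hj
        exact absurd (mem_filter.2 ⟨he, hc⟩) hj
    -- Keeping only these two classes bounds twice the Rayleigh difference below by `(S - s (c e) -
    -- s (c f)) ^ 2`.
    have h2 : s (c e) ^ 2 + s (c f) ^ 2 ≤ ∑ k ∈ E.image c, s k ^ 2 := by
      rw [← sum_pair (f := fun k => s k ^ 2) hc]
      refine sum_le_sum_of_subset_of_nonneg ?_ fun _ _ _ => sq_nonneg _
      exact insert_subset (mem_image_of_mem c he) (singleton_subset_iff.2 (mem_image_of_mem c hf))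
    rw [h1]
    nlinarith [sq_nonneg (S - s (c e) - s (c f))]

end RankTwo

/-! ### Decidable combinatorial conditions for the rank-three criterion. -/

section LineFree

variable {σ : Type*} [DecidableEq σ]

/-- The `r`-element subsets of `E` that are not contained in a member of `L`. -/
def lineFree (E : Finset σ) (r : ℕ) (L : Finset (Finset σ)) : Finset (Finset σ) :=
  (powersetCard r E).filter fun B => ∀ A ∈ L, ¬ B ⊆ A

lemma lineFree_subset (E : Finset σ) (r : ℕ) (L : Finset (Finset σ)) :
    lineFree E r L ⊆ powersetCard r E := filter_subset _ _

lemma contractFamily_subset_powersetCard {𝓑 : Finset (Finset σ)} {E : Finset σ} {r : ℕ}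
    (h : 𝓑 ⊆ powersetCard (r + 1) E) (e : σ) :
    contractFamily 𝓑 e ⊆ powersetCard r (E.erase e) := by
  intro B hB
  obtain ⟨C, hC, rfl⟩ := mem_image.1 hB
  obtain ⟨hC, heC⟩ := mem_filter.1 hC
  obtain ⟨hCE, hCr⟩ := mem_powersetCard.1 (h hC)
  refine mem_powersetCard.2 ⟨erase_subset_erase e hCE, ?_⟩
  rw [card_erase_of_mem heC, hCr, Nat.add_sub_cancel]

/-- The points on a line through `e` and `i`, other than `e`. -/
def pencilClass (L : Finset (Finset σ)) (e i : σ) : Finset σ :=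
  insert i (((L.filter fun A => e ∈ A ∧ i ∈ A).biUnion id).erase e)

/-- The contraction of `e` is the rank-two matroid whose parallel classes are the lines
through `e`. -/
def IsPencil (E : Finset σ) (𝓑 L : Finset (Finset σ)) (e : σ) : Prop :=
  ∀ i ∈ E.erase e, contractFamily (contractFamily 𝓑 e) i
    = ((E.erase e).filter (pencilClass L e · ≠ pencilClass L e i)).image singleton

instance (E : Finset σ) (𝓑 L : Finset (Finset σ)) (e : σ) : Decidable (IsPencil E 𝓑 L e) :=
  inferInstanceAs (Decidable (∀ i ∈ E.erase e, _))

/-- The inequality `Z_g Z_h ≠ Z_gh Z` of the generating polynomials at the point `(1, …, 1)`. -/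
def ContractNondegenerate (𝓑 : Finset (Finset σ)) (g h : σ) : Prop :=
  #(contractFamily 𝓑 g) * #(contractFamily 𝓑 h) ≠
    #(contractFamily (contractFamily 𝓑 h) g) * #𝓑

instance (𝓑 : Finset (Finset σ)) (g h : σ) : Decidable (ContractNondegenerate 𝓑 g h) :=
  inferInstanceAs (Decidable (_ ≠ _))

/-- A list of lists enumerates the members of a family and their elements without repetition. -/
def Enumerates (l : List (List σ)) (𝓑 : Finset (Finset σ)) : Prop :=
  𝓑 = (l.map List.toFinset).toFinset ∧ (l.map List.toFinset).Nodup ∧ ∀ a ∈ l, a.Nodup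

instance (l : List (List σ)) (𝓑 : Finset (Finset σ)) : Decidable (Enumerates l 𝓑) :=
  inferInstanceAs (Decidable (_ ∧ _))

lemma Enumerates.eval_eq {l : List (List σ)} {𝓑 : Finset (Finset σ)} (h : Enumerates l 𝓑)
    (y : σ → ℝ) : eval y (setPoly 𝓑) = (l.map fun a => (a.map y).prod).sum := by
  obtain ⟨rfl, h1, h2⟩ := h
  exact eval_setPoly_toFinset l h1 h2 y

/-- Explicit enumerations of the deletions and contractions of `e` and `f`. -/
structure PairMinors (𝓑 : Finset (Finset σ)) (e f : σ) (b c d a : List (List σ)) : Prop where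
  ne : e ≠ f
  con_del : Enumerates b (contractFamily (deleteFamily 𝓑 f) e)
  del_con : Enumerates c (deleteFamily (contractFamily 𝓑 f) e)
  con_con : Enumerates d (contractFamily (contractFamily 𝓑 f) e)
  del_del : Enumerates a (deleteFamily (deleteFamily 𝓑 f) e)

instance (𝓑 : Finset (Finset σ)) (e f : σ) (b c d a : List (List σ)) :
    Decidable (PairMinors 𝓑 e f b c d a) :=
  decidable_of_iff (e ≠ f ∧ Enumerates b (contractFamily (deleteFamily 𝓑 f) e) ∧
    Enumerates c (deleteFamily (contractFamily 𝓑 f) e) ∧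
    Enumerates d (contractFamily (contractFamily 𝓑 f) e) ∧
    Enumerates a (deleteFamily (deleteFamily 𝓑 f) e))
    ⟨fun ⟨h1, h2, h3, h4, h5⟩ => ⟨h1, h2, h3, h4, h5⟩,
      fun h => ⟨h.ne, h.con_del, h.del_con, h.con_con, h.del_del⟩⟩

lemma PairMinors.eval_rayleighDiff {𝓑 : Finset (Finset σ)} {e f : σ} {b c d a : List (List σ)}
    (h : PairMinors 𝓑 e f b c d a) (y : σ → ℝ) :
    eval y (rayleighDiff (setPoly 𝓑) e f) =
      (b.map fun s => (s.map y).prod).sum * (c.map fun s => (s.map y).prod).sum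
      - (d.map fun s => (s.map y).prod).sum * (a.map fun s => (s.map y).prod).sum := by
  rw [eval_rayleighDiff_setPoly 𝓑 h.ne, h.con_del.eval_eq, h.del_con.eval_eq, h.con_con.eval_eq,
    h.del_del.eval_eq]

/-- The combinatorial conditions on a rank-three matroid under which its strong Rayleigh property
follows from the nonnegativity of `ΔZ{e,f}`: the lines through `e` and `f` are those of `L`, and
the contractions of `e` and `f` are not degenerate. -/
structure RankThreePair (E : Finset σ) (𝓑 L : Finset (Finset σ)) (e f : σ) : Prop where
  subset : 𝓑 ⊆ powersetCard 3 E
  left_mem : e ∈ E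
  right_mem : f ∈ E
  pencil_left : IsPencil E 𝓑 L e
  pencil_right : IsPencil E 𝓑 L f
  nondeg_left : ∀ g ∈ E, ∀ h ∈ E, g ≠ e → h ≠ e → g ≠ h →
    ContractNondegenerate (contractFamily 𝓑 e) g h
  nondeg_right : ∀ g ∈ E, g ≠ e → g ≠ f → ContractNondegenerate (contractFamily 𝓑 f) e g

instance (E : Finset σ) (𝓑 L : Finset (Finset σ)) (e f : σ) :
    Decidable (RankThreePair E 𝓑 L e f) :=
  decidable_of_iff (𝓑 ⊆ powersetCard 3 E ∧ e ∈ E ∧ f ∈ E ∧ IsPencil E 𝓑 L e ∧ IsPencil E 𝓑 L f ∧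
    (∀ g ∈ E, ∀ h ∈ E, g ≠ e → h ≠ e → g ≠ h →
      ContractNondegenerate (contractFamily 𝓑 e) g h) ∧
    ∀ g ∈ E, g ≠ e → g ≠ f → ContractNondegenerate (contractFamily 𝓑 f) e g)
    ⟨fun ⟨h1, h2, h3, h4, h5, h6, h7⟩ => ⟨h1, h2, h3, h4, h5, h6, h7⟩,
      fun h => ⟨h.subset, h.left_mem, h.right_mem, h.pencil_left, h.pencil_right, h.nondeg_left,
        h.nondeg_right⟩⟩

/-- A rank-three matroid is strongly Rayleigh if one of its Rayleigh differences is nonnegative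
(and the contractions of the two points are not degenerate). -/
theorem RankThreePair.isStronglyRayleigh {E : Finset σ} {𝓑 L : Finset (Finset σ)} {e f : σ}
    (h : RankThreePair E 𝓑 L e f) (hne : e ≠ f)
    (hef : ∀ y, 0 ≤ eval y (rayleighDiff (setPoly 𝓑) e f)) :
    IsStronglyRayleigh (E : Set σ) (setPoly 𝓑) := by
  have hcon : ∀ i, IsPencil E 𝓑 L i → IsStronglyRayleigh (E : Set σ) (pderiv i (setPoly 𝓑)) := by
    intro i hi
    refine IsStronglyRayleigh.of_erase (e := i) ?_ (isMultiaffine_setPoly 𝓑 i)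
    rw [pderiv_setPoly, ← coe_erase]
    exact isStronglyRayleigh_of_rank_two (contractFamily_subset_powersetCard h.subset i) _ hi
  refine IsStronglyRayleigh.of_pair (isMultiaffine_setPoly 𝓑) h.right_mem h.left_mem hne hef
    (hcon e h.pencil_left) (hcon f h.pencil_right) (fun g hg k hk hge hke hgk => ?_)
    fun g hg hge hgf => ?_
  · rw [pderiv_setPoly]
    exact exists_eval_rayleighDiff_setPoly_ne_zero (h.nondeg_left g hg k hk hge hke hgk)
  · rw [pderiv_setPoly]
    exact exists_eval_rayleighDiff_setPoly_ne_zero (h.nondeg_right g hg hge hgf)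

end LineFree

/-! ### From basis families to the matroids and their deletions. -/

namespace Matroid

lemma paving_isBase_iff {α : Type*} [DecidableEq α] {E : Finset α} {r : ℕ} {L : Finset (Finset α)}
    {hL hne} (B : Finset α) :
    (paving E r L hL hne).IsBase (B : Set α) ↔ B ∈ lineFree E r L := by
  change (∃ C : Finset α, (C : Set α) = B ∧ C ⊆ E ∧ #C = r ∧ ∀ A ∈ L, ¬ C ⊆ A) ↔ _
  simp [lineFree, and_assoc]

lemma paving_ground {α : Type*} [DecidableEq α] {E : Finset α} {r : ℕ} {L : Finset (Finset α)}
    {hL hne} : (paving E r L hL hne).E = E := rfl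

lemma basisPoly_eq_setPoly {α : Type*} {M : Matroid α} [M.Finite] {𝓑 : Finset (Finset α)}
    (h : ∀ B : Finset α, M.IsBase (B : Set α) ↔ B ∈ 𝓑) : M.basisPoly = setPoly 𝓑 := by
  unfold basisPoly setPoly
  congr 1
  ext B
  simp only [mem_filter, h, and_iff_right_iff_imp, mem_powerset]
  intro hB i hi
  rw [Set.Finite.mem_toFinset]
  exact ((h B).2 hB).subset_ground hi

lemma hpp_and_stronglyRayleigh {α : Type*} [DecidableEq α] {M : Matroid α} [M.Finite]
    {E : Finset α} {r : ℕ} {𝓑 : Finset (Finset α)} (hME : M.E = E)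
    (h : ∀ B : Finset α, M.IsBase (B : Set α) ↔ B ∈ 𝓑) (hE : 𝓑 ⊆ powersetCard r E)
    (hS : IsStronglyRayleigh (E : Set α) (setPoly 𝓑)) : M.HPP ∧ M.StronglyRayleigh := by
  unfold HPP StronglyRayleigh
  rw [basisPoly_eq_setPoly h, hME]
  refine ⟨hS.hasHalfPlaneProperty ?_ hE, hS⟩
  obtain ⟨B, hB⟩ := M.exists_isBase
  obtain ⟨B, rfl⟩ := (M.ground_finite.subset hB.subset_ground).exists_finset_coe
  exact ⟨B, (h B).1 hB⟩

lemma paving_hpp {α : Type*} [DecidableEq α] {E : Finset α} {r : ℕ} {L : Finset (Finset α)}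
    {hL hne} (hS : IsStronglyRayleigh (E : Set α) (setPoly (lineFree E r L))) :
    (paving E r L hL hne).HPP ∧ (paving E r L hL hne).StronglyRayleigh :=
  hpp_and_stronglyRayleigh paving_ground paving_isBase_iff (lineFree_subset E r L) hS

/-- Some basis avoids `e`, so `{e}` is coindependent and the bases of the deletion are the bases
avoiding `e`. The members of `L` need no truncation, since a set avoiding `e` is tested against them
in the same way. -/
lemma paving_delete_hpp {α : Type*} [DecidableEq α] {E : Finset α} {r : ℕ}
    {L : Finset (Finset α)} {hL hne} {e : α} (heE : e ∈ E)
    (he : (lineFree (E.erase e) r L).Nonempty)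
    (hS : IsStronglyRayleigh (E.erase e : Set α) (setPoly (lineFree (E.erase e) r L))) :
    ((paving E r L hL hne).delete {e}).HPP ∧
      ((paving E r L hL hne).delete {e}).StronglyRayleigh := by
  have hmem : ∀ B, B ∈ lineFree (E.erase e) r L ↔ B ∈ lineFree E r L ∧ e ∉ B := by
    intro B
    simp only [lineFree, mem_filter, mem_powersetCard, subset_erase]
    tauto
  refine hpp_and_stronglyRayleigh (E := E.erase e) (r := r) (by simp [paving_ground])
    (fun B => ?_) (lineFree_subset _ r L) hS
  rw [Coindep.delete_isBase_iff, paving_isBase_iff, hmem]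
  · simp
  · obtain ⟨B, hB⟩ := he
    rw [hmem] at hB
    rw [coindep_iff_subset_compl_isBase]
    refine ⟨B, (paving_isBase_iff B).2 hB.1, ?_⟩
    simp [paving_ground, heE, hB.2]

end Matroid

/-! ### Sum-of-squares certificates for the individual matroids. -/

section Certificates

/-- The Rayleigh difference of two points `e`, `f` on distinct lines of a seven-point matroid whose
lines are `p e a`, `p f b` and `p c d`. -/
theorem rayleighDiff_nonneg_of_concurrent {𝓑 : Finset (Finset ℕ)} {p e a f b c d : ℕ}
    (hm : PairMinors 𝓑 e f
    [[p, c], [p, d], [p, b], [a, c], [a, d], [a, b], [c, d], [c, b], [d, b]]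
    [[p, a], [p, c], [p, d], [a, c], [a, d], [a, b], [c, d], [c, b], [d, b]]
    [[p], [a], [c], [d], [b]]
    [[p, a, c], [p, a, d], [p, a, b], [p, c, b], [p, d, b], [a, c, d], [a, c, b], [a, d, b],
      [c, d, b]]) (y : ℕ → ℝ) :
    0 ≤ eval y (rayleighDiff (setPoly 𝓑) e f) := by
  rw [hm.eval_rayleighDiff]
  simp only [List.map_cons, List.map_nil, List.prod_cons, List.prod_nil, List.sum_cons,
    List.sum_nil]
  -- Here and in the later certificates the squares have the triangular shape of successive
  -- completion of squares: the first monomial of each is absent from all later ones.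
  linear_combination
    (1 / 4 : ℝ) * sq_nonneg (2 * y p * y c + 2 * y p * y d + y a * y c + y a * y d + 2 * y c * y d
      + y c * y b + y d * y b) +
    (1 / 12 : ℝ) * sq_nonneg (3 * y a * y c + y a * y d + 2 * y a * y b + y c * y b
      + 3 * y d * y b) +
    (1 / 6 : ℝ) * sq_nonneg (2 * y a * y d + y a * y b - y c * y b) +
    (1 / 2 : ℝ) * sq_nonneg (y a * y b + y c * y b)

/-- `W³⁺` is strongly Rayleigh. -/
theorem isStronglyRayleigh_W3plus : IsStronglyRayleigh ((Icc 1 7 : Finset ℕ) : Set ℕ)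
    (setPoly (lineFree (Icc 1 7) 3
      {{1, 2, 3, 7}, {3, 4, 5}, {1, 5, 6}})) := by
  set 𝓑 := lineFree (Icc 1 7) 3
    {{1, 2, 3, 7}, {3, 4, 5}, {1, 5, 6}}
  -- As in the other rank-three cases, the chosen pair lies on no listed line, so every further
  -- point completes it to a basis.
  have hp : RankThreePair (Icc 1 7) 𝓑
      {{1, 2, 3, 7}, {3, 4, 5}, {1, 5, 6}} 2 5 := by decide +kernel
  have hm : PairMinors 𝓑 2 5
    [[1, 4], [1, 6], [3, 4], [3, 6], [4, 6], [4, 7], [6, 7]]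
    [[1, 3], [1, 4], [1, 7], [3, 6], [3, 7], [4, 6], [4, 7], [6, 7]]
    [[1], [3], [4], [6], [7]]
    [[1, 3, 4], [1, 3, 6], [1, 4, 6], [1, 4, 7], [1, 6, 7], [3, 4, 6], [3, 4, 7], [3, 6, 7],
      [4, 6, 7]] := by
    decide +kernel
  refine hp.isStronglyRayleigh hm.ne fun y => ?_
  rw [hm.eval_rayleighDiff]
  simp only [List.map_cons, List.map_nil, List.prod_cons, List.prod_nil, List.sum_cons,
    List.sum_nil]
  linear_combination
    (1 / 4 : ℝ) * sq_nonneg (2 * y 1 * y 4 - y 3 * y 6 + y 4 * y 6 + y 4 * y 7) +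
    (1 / 12 : ℝ) * sq_nonneg (3 * y 3 * y 6 + 3 * y 4 * y 6 + y 4 * y 7 + 2 * y 6 * y 7) +
    (1 / 6 : ℝ) * sq_nonneg (2 * y 4 * y 7 + y 6 * y 7) +
    (1 / 2 : ℝ) * sq_nonneg (y 6 * y 7)

/-- `W³ + e` is strongly Rayleigh. -/
theorem isStronglyRayleigh_W3adde : IsStronglyRayleigh ((Icc 1 7 : Finset ℕ) : Set ℕ)
    (setPoly (lineFree (Icc 1 7) 3
      {{1, 2, 3}, {3, 4, 5}, {1, 5, 6}})) := by
  set 𝓑 := lineFree (Icc 1 7) 3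
    {{1, 2, 3}, {3, 4, 5}, {1, 5, 6}}
  have hp : RankThreePair (Icc 1 7) 𝓑
      {{1, 2, 3}, {3, 4, 5}, {1, 5, 6}} 1 4 := by decide +kernel
  have hm : PairMinors 𝓑 1 4
    [[2, 5], [2, 6], [2, 7], [3, 5], [3, 6], [3, 7], [5, 7], [6, 7]]
    [[2, 3], [2, 5], [2, 6], [2, 7], [3, 6], [3, 7], [5, 6], [5, 7], [6, 7]]
    [[2], [3], [5], [6], [7]]
    [[2, 3, 5], [2, 3, 6], [2, 3, 7], [2, 5, 6], [2, 5, 7], [2, 6, 7], [3, 5, 6], [3, 5, 7],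
      [3, 6, 7], [5, 6, 7]] := by
    decide +kernel
  refine hp.isStronglyRayleigh hm.ne fun y => ?_
  rw [hm.eval_rayleighDiff]
  simp only [List.map_cons, List.map_nil, List.prod_cons, List.prod_nil, List.sum_cons,
    List.sum_nil]
  linear_combination
    (1 / 4 : ℝ) * sq_nonneg (2 * y 2 * y 5 + y 2 * y 6 + y 2 * y 7 - y 3 * y 6 + y 5 * y 7) +
    (1 / 12 : ℝ) * sq_nonneg (3 * y 2 * y 6 + y 2 * y 7 + 3 * y 3 * y 6 + 2 * y 3 * y 7
      + y 5 * y 7 + 2 * y 6 * y 7) +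
    (1 / 24 : ℝ) * sq_nonneg (4 * y 2 * y 7 + 2 * y 3 * y 7 + y 5 * y 7 + 2 * y 6 * y 7) +
    (1 / 8 : ℝ) * sq_nonneg (2 * y 3 * y 7 + y 5 * y 7) +
    (1 / 8 : ℝ) * sq_nonneg (2 * y 5 * y 7 + y 6 * y 7) +
    (3 / 8 : ℝ) * sq_nonneg (y 6 * y 7)

/-- `P₇'` is strongly Rayleigh. -/
theorem isStronglyRayleigh_P7prime : IsStronglyRayleigh ((Icc 1 7 : Finset ℕ) : Set ℕ)
    (setPoly (lineFree (Icc 1 7) 3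
      {{1, 2, 3}, {1, 5, 6}, {2, 6, 7}, {3, 4, 5}})) := by
  set 𝓑 := lineFree (Icc 1 7) 3
    {{1, 2, 3}, {1, 5, 6}, {2, 6, 7}, {3, 4, 5}}
  have hp : RankThreePair (Icc 1 7) 𝓑
      {{1, 2, 3}, {1, 5, 6}, {2, 6, 7}, {3, 4, 5}} 2 5 := by decide +kernel
  have hm : PairMinors 𝓑 2 5
    [[1, 4], [1, 6], [1, 7], [3, 4], [3, 6], [3, 7], [4, 6], [4, 7]]
    [[1, 3], [1, 4], [1, 7], [3, 6], [3, 7], [4, 6], [4, 7], [6, 7]]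
    [[1], [3], [4], [6], [7]]
    [[1, 3, 4], [1, 3, 6], [1, 3, 7], [1, 4, 6], [1, 4, 7], [1, 6, 7], [3, 4, 6], [3, 4, 7],
      [3, 6, 7], [4, 6, 7]] := by
    decide +kernel
  refine hp.isStronglyRayleigh hm.ne fun y => ?_
  rw [hm.eval_rayleighDiff]
  simp only [List.map_cons, List.map_nil, List.prod_cons, List.prod_nil, List.sum_cons,
    List.sum_nil]
  linear_combination
    (1 / 4 : ℝ) * sq_nonneg (2 * y 1 * y 4 + y 1 * y 7 - y 3 * y 6 + y 4 * y 6 + y 4 * y 7) +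
    (1 / 12 : ℝ) * sq_nonneg (3 * y 1 * y 7 - y 3 * y 6 + 2 * y 3 * y 7 - y 4 * y 6 + y 4 * y 7) +
    (1 / 6 : ℝ) * sq_nonneg (2 * y 3 * y 6 + 2 * y 3 * y 7 + 2 * y 4 * y 6 + y 4 * y 7) +
    (1 / 2 : ℝ) * sq_nonneg (y 4 * y 7)

/-- The deletion of `1` from the non-Pappus matroid is strongly Rayleigh. -/
theorem isStronglyRayleigh_nonPappus_delete_one :
    IsStronglyRayleigh (((Icc 1 9).erase 1 : Finset ℕ) : Set ℕ)
    (setPoly (lineFree ((Icc 1 9).erase 1) 3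
      {{1, 2, 3}, {4, 5, 6}, {1, 5, 7}, {2, 4, 7}, {1, 6, 8}, {3, 4, 8}, {2, 6, 9}, {3, 5, 9}})) := by
  set 𝓑 := lineFree ((Icc 1 9).erase 1) 3
    {{1, 2, 3}, {4, 5, 6}, {1, 5, 7}, {2, 4, 7}, {1, 6, 8}, {3, 4, 8}, {2, 6, 9}, {3, 5, 9}}
  have hp : RankThreePair ((Icc 1 9).erase 1) 𝓑
      {{1, 2, 3}, {4, 5, 6}, {1, 5, 7}, {2, 4, 7}, {1, 6, 8}, {3, 4, 8}, {2, 6, 9}, {3, 5, 9}} 4 9 := by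
    decide +kernel
  have hm : PairMinors 𝓑 4 9
    [[2, 3], [2, 5], [2, 6], [2, 8], [3, 5], [3, 6], [3, 7], [5, 7], [5, 8], [6, 7], [6, 8],
      [7, 8]]
    [[2, 3], [2, 5], [2, 7], [2, 8], [3, 6], [3, 7], [3, 8], [5, 6], [5, 7], [5, 8], [6, 7],
      [6, 8], [7, 8]]
    [[2], [3], [5], [6], [7], [8]]
    [[2, 3, 5], [2, 3, 6], [2, 3, 7], [2, 3, 8], [2, 5, 6], [2, 5, 7], [2, 5, 8], [2, 6, 7],
      [2, 6, 8], [2, 7, 8], [3, 5, 6], [3, 5, 7], [3, 5, 8], [3, 6, 7], [3, 6, 8], [3, 7, 8],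
      [5, 6, 7], [5, 6, 8], [5, 7, 8], [6, 7, 8]] := by
    decide +kernel
  refine hp.isStronglyRayleigh hm.ne fun y => ?_
  rw [hm.eval_rayleighDiff]
  simp only [List.map_cons, List.map_nil, List.prod_cons, List.prod_nil, List.sum_cons,
    List.sum_nil]
  linear_combination
    (1 / 4 : ℝ) * sq_nonneg (2 * y 2 * y 3 + y 2 * y 5 + y 2 * y 8 + y 3 * y 6 + y 3 * y 7
      + y 5 * y 7 + y 6 * y 8) +
    (1 / 12 : ℝ) * sq_nonneg (3 * y 2 * y 5 + y 2 * y 8 - 3 * y 3 * y 6 - y 3 * y 7 + y 5 * y 7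
      + 2 * y 5 * y 8 - 2 * y 6 * y 7 - y 6 * y 8) +
    (1 / 24 : ℝ) * sq_nonneg (4 * y 2 * y 8 - y 3 * y 7 + y 5 * y 7 + 2 * y 5 * y 8 + y 6 * y 7
      + 2 * y 6 * y 8 + 3 * y 7 * y 8) +
    (1 / 40 : ℝ) * sq_nonneg (5 * y 3 * y 7 + 3 * y 5 * y 7 + 2 * y 5 * y 8 + 3 * y 6 * y 7
      + 2 * y 6 * y 8 + 5 * y 7 * y 8) +
    (1 / 40 : ℝ) * sq_nonneg (4 * y 5 * y 7 + y 5 * y 8 + 4 * y 6 * y 7 + y 6 * y 8) +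
    (3 / 8 : ℝ) * sq_nonneg (y 5 * y 8 + y 6 * y 8)

/-- The deletion of `9` from the non-Pappus matroid is strongly Rayleigh. -/
theorem isStronglyRayleigh_nonPappus_delete_nine :
    IsStronglyRayleigh (((Icc 1 9).erase 9 : Finset ℕ) : Set ℕ)
    (setPoly (lineFree ((Icc 1 9).erase 9) 3
      {{1, 2, 3}, {4, 5, 6}, {1, 5, 7}, {2, 4, 7}, {1, 6, 8}, {3, 4, 8}, {2, 6, 9}, {3, 5, 9}})) := by
  set 𝓑 := lineFree ((Icc 1 9).erase 9) 3
    {{1, 2, 3}, {4, 5, 6}, {1, 5, 7}, {2, 4, 7}, {1, 6, 8}, {3, 4, 8}, {2, 6, 9}, {3, 5, 9}}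
  have hp : RankThreePair ((Icc 1 9).erase 9) 𝓑
      {{1, 2, 3}, {4, 5, 6}, {1, 5, 7}, {2, 4, 7}, {1, 6, 8}, {3, 4, 8}, {2, 6, 9}, {3, 5, 9}} 1 4 := by
    decide +kernel
  have hm : PairMinors 𝓑 1 4
    [[2, 5], [2, 6], [2, 7], [2, 8], [3, 5], [3, 6], [3, 7], [3, 8], [5, 6], [5, 8], [6, 7],
      [7, 8]]
    [[2, 3], [2, 5], [2, 6], [2, 8], [3, 5], [3, 6], [3, 7], [5, 7], [5, 8], [6, 7], [6, 8],
      [7, 8]]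
    [[2], [3], [5], [6], [7], [8]]
    [[2, 3, 5], [2, 3, 6], [2, 3, 7], [2, 3, 8], [2, 5, 6], [2, 5, 7], [2, 5, 8], [2, 6, 7],
      [2, 6, 8], [2, 7, 8], [3, 5, 6], [3, 5, 7], [3, 5, 8], [3, 6, 7], [3, 6, 8], [3, 7, 8],
      [5, 6, 7], [5, 6, 8], [5, 7, 8], [6, 7, 8]] := by
    decide +kernel
  refine hp.isStronglyRayleigh hm.ne fun y => ?_
  rw [hm.eval_rayleighDiff]
  simp only [List.map_cons, List.map_nil, List.prod_cons, List.prod_nil, List.sum_cons,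
    List.sum_nil]
  linear_combination
    (1 / 4 : ℝ) * sq_nonneg (2 * y 2 * y 5 + y 2 * y 6 + y 2 * y 8 + y 3 * y 5 - y 3 * y 7
      + y 5 * y 8 - y 6 * y 7) +
    (1 / 12 : ℝ) * sq_nonneg (3 * y 2 * y 6 + y 2 * y 8 + y 3 * y 5 + 2 * y 3 * y 6 + y 3 * y 7
      - y 5 * y 8 + 3 * y 6 * y 7 + 2 * y 7 * y 8) +
    (1 / 6 : ℝ) * sq_nonneg (2 * y 2 * y 8 - y 3 * y 5 - 2 * y 3 * y 6 - y 3 * y 7 + y 5 * y 8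
      + y 7 * y 8) +
    (1 / 2 : ℝ) * sq_nonneg (y 3 * y 5 + y 3 * y 7 + y 5 * y 8 + y 7 * y 8)

/-- The Rayleigh difference of the points `1` and `2` of the Vámos cube is a sum of squares. -/
theorem rayleighDiff_vamos_nonneg (y : ℕ → ℝ) :
    0 ≤ eval y (rayleighDiff (setPoly (lineFree (Icc 1 8) 4
      {{1, 2, 3, 4}, {1, 4, 5, 6}, {1, 4, 7, 8}, {2, 3, 5, 6}, {2, 3, 7, 8}})) 1 2) := by
  have hm : PairMinors (lineFree (Icc 1 8) 4
      {{1, 2, 3, 4}, {1, 4, 5, 6}, {1, 4, 7, 8}, {2, 3, 5, 6}, {2, 3, 7, 8}}) 1 2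
    [[3, 4, 5], [3, 4, 6], [3, 4, 7], [3, 4, 8], [3, 5, 6], [3, 5, 7], [3, 5, 8], [3, 6, 7],
      [3, 6, 8], [3, 7, 8], [4, 5, 7], [4, 5, 8], [4, 6, 7], [4, 6, 8], [5, 6, 7], [5, 6, 8],
      [5, 7, 8], [6, 7, 8]]
    [[3, 4, 5], [3, 4, 6], [3, 4, 7], [3, 4, 8], [3, 5, 7], [3, 5, 8], [3, 6, 7], [3, 6, 8],
      [4, 5, 6], [4, 5, 7], [4, 5, 8], [4, 6, 7], [4, 6, 8], [4, 7, 8], [5, 6, 7], [5, 6, 8],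
      [5, 7, 8], [6, 7, 8]]
    [[3, 5], [3, 6], [3, 7], [3, 8], [4, 5], [4, 6], [4, 7], [4, 8], [5, 6], [5, 7], [5, 8],
      [6, 7], [6, 8], [7, 8]]
    [[3, 4, 5, 6], [3, 4, 5, 7], [3, 4, 5, 8], [3, 4, 6, 7], [3, 4, 6, 8], [3, 4, 7, 8],
      [3, 5, 6, 7], [3, 5, 6, 8], [3, 5, 7, 8], [3, 6, 7, 8], [4, 5, 6, 7], [4, 5, 6, 8],
      [4, 5, 7, 8], [4, 6, 7, 8], [5, 6, 7, 8]] := by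
    decide +kernel
  rw [hm.eval_rayleighDiff]
  simp only [List.map_cons, List.map_nil, List.prod_cons, List.prod_nil, List.sum_cons,
    List.sum_nil]
  linear_combination
    (1 / 4 : ℝ) * sq_nonneg (2 * y 3 * y 4 * y 5 + 2 * y 3 * y 4 * y 6 + 2 * y 3 * y 4 * y 7
      + 2 * y 3 * y 4 * y 8 + y 3 * y 5 * y 7 + y 3 * y 5 * y 8 + y 3 * y 6 * y 7
      + y 3 * y 6 * y 8 + y 4 * y 5 * y 7 + y 4 * y 5 * y 8 + y 4 * y 6 * y 7 + y 4 * y 6 * y 8) +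
    (1 / 108 : ℝ) * sq_nonneg (9 * y 3 * y 5 * y 7 + 3 * y 3 * y 5 * y 8 + 3 * y 3 * y 6 * y 7
      - 3 * y 3 * y 6 * y 8 + 3 * y 4 * y 5 * y 7 + y 4 * y 5 * y 8 + 5 * y 4 * y 6 * y 7
      + 3 * y 4 * y 6 * y 8 + 6 * y 5 * y 6 * y 7 + 2 * y 5 * y 6 * y 8 + 6 * y 5 * y 7 * y 8
      + 2 * y 6 * y 7 * y 8) +
    (1 / 216 : ℝ) * sq_nonneg (12 * y 3 * y 5 * y 8 - 6 * y 3 * y 6 * y 7 + 6 * y 3 * y 6 * y 8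
      + 6 * y 4 * y 5 * y 7 + 4 * y 4 * y 5 * y 8 + 2 * y 4 * y 6 * y 7 + 3 * y 5 * y 6 * y 7
      + 8 * y 5 * y 6 * y 8 + 6 * y 5 * y 7 * y 8 + 2 * y 6 * y 7 * y 8) +
    (1 / 72 : ℝ) * sq_nonneg (6 * y 3 * y 6 * y 7 + 6 * y 3 * y 6 * y 8 + 2 * y 4 * y 5 * y 7
      + 4 * y 4 * y 5 * y 8 + 2 * y 4 * y 6 * y 7 + 4 * y 4 * y 6 * y 8 + 5 * y 5 * y 6 * y 7
      + 4 * y 5 * y 6 * y 8 + 4 * y 5 * y 7 * y 8 + 6 * y 6 * y 7 * y 8) +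
    (1 / 144 : ℝ) * sq_nonneg (8 * y 4 * y 5 * y 7 - 8 * y 4 * y 6 * y 8 + 2 * y 5 * y 6 * y 7
      - 4 * y 5 * y 6 * y 8 + y 5 * y 7 * y 8 - 2 * y 6 * y 7 * y 8) +
    (1 / 144 : ℝ) * sq_nonneg (8 * y 4 * y 5 * y 8 - 8 * y 4 * y 6 * y 7 - y 5 * y 6 * y 7
      + 2 * y 5 * y 6 * y 8 + 2 * y 5 * y 7 * y 8 - 4 * y 6 * y 7 * y 8) +
    (1 / 5040 : ℝ) * sq_nonneg (35 * y 5 * y 6 * y 7 + 10 * y 5 * y 6 * y 8 - 28 * y 5 * y 7 * y 8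
      - 8 * y 6 * y 7 * y 8) +
    (1 / 56 : ℝ) * sq_nonneg (4 * y 5 * y 6 * y 8 + y 6 * y 7 * y 8) +
    (1 / 560 : ℝ) * sq_nonneg (7 * y 5 * y 7 * y 8 + 2 * y 6 * y 7 * y 8) +
    (15 / 56 : ℝ) * sq_nonneg (y 6 * y 7 * y 8)

/-- `F₇⁻⁴` is strongly Rayleigh. -/
theorem isStronglyRayleigh_F7m4 : IsStronglyRayleigh ((Icc 1 7 : Finset ℕ) : Set ℕ)
    (setPoly (lineFree (Icc 1 7) 3 {{1, 2, 3}, {1, 4, 7}, {1, 5, 6}})) := by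
  have hp : RankThreePair (Icc 1 7) (lineFree (Icc 1 7) 3 {{1, 2, 3}, {1, 4, 7}, {1, 5, 6}})
      {{1, 2, 3}, {1, 4, 7}, {1, 5, 6}} 2 4 := by decide +kernel
  exact hp.isStronglyRayleigh (by decide) (rayleighDiff_nonneg_of_concurrent
    (p := 1) (a := 3) (b := 7) (c := 5) (d := 6) (by decide +kernel))

/-- The Vámos cube is strongly Rayleigh. -/
theorem isStronglyRayleigh_vamos : IsStronglyRayleigh ((Icc 1 8 : Finset ℕ) : Set ℕ)
    (setPoly (lineFree (Icc 1 8) 4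
      {{1, 2, 3, 4}, {1, 4, 5, 6}, {1, 4, 7, 8}, {2, 3, 5, 6}, {2, 3, 7, 8}})) := by
  set 𝓑 := lineFree (Icc 1 8) 4
    {{1, 2, 3, 4}, {1, 4, 5, 6}, {1, 4, 7, 8}, {2, 3, 5, 6}, {2, 3, 7, 8}} with h𝓑
  -- The planes through `1` become three lines through `4`, and those through `2` three lines
  -- through `3`. Both contractions thus have the configuration of `F₇⁻⁴`.
  have h1 : RankThreePair ((Icc 1 8).erase 1) (contractFamily 𝓑 1)
      {{4, 2, 3}, {4, 5, 6}, {4, 7, 8}} 2 5 := by decide +kernel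
  have h2 : RankThreePair ((Icc 1 8).erase 2) (contractFamily 𝓑 2)
      {{3, 1, 4}, {3, 5, 6}, {3, 7, 8}} 1 5 := by decide +kernel
  have s1 := h1.isStronglyRayleigh (by decide) (rayleighDiff_nonneg_of_concurrent
    (p := 4) (a := 3) (b := 6) (c := 7) (d := 8) (by decide +kernel))
  have s2 := h2.isStronglyRayleigh (by decide) (rayleighDiff_nonneg_of_concurrent
    (p := 3) (a := 4) (b := 6) (c := 7) (d := 8) (by decide +kernel))
  rw [coe_erase, ← pderiv_setPoly] at s1 s2
  have n1 : ∀ g ∈ Icc 1 8, ∀ h ∈ Icc 1 8, g ≠ 1 → h ≠ 1 → g ≠ h →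
      ContractNondegenerate (contractFamily 𝓑 1) g h := by decide +kernel
  have n2 : ∀ g ∈ Icc 1 8, g ≠ 1 → g ≠ 2 →
      ContractNondegenerate (contractFamily 𝓑 2) 1 g := by decide +kernel
  refine IsStronglyRayleigh.of_pair (isMultiaffine_setPoly 𝓑) (e := 1) (f := 2) (by simp)
    (by simp) (by decide) rayleighDiff_vamos_nonneg
    (s1.of_erase (isMultiaffine_setPoly 𝓑 1)) (s2.of_erase (isMultiaffine_setPoly 𝓑 2))
    (fun g hg h hh hge hhe hgh => ?_) fun g hg hge hgf => ?_
  · rw [pderiv_setPoly]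
    exact exists_eval_rayleighDiff_setPoly_ne_zero (n1 g hg h hh hge hhe hgh)
  · rw [pderiv_setPoly]
    exact exists_eval_rayleighDiff_setPoly_ne_zero (n2 g hg hge hgf)

end Certificates

theorem mainTheorem3 :
    (Matroid.F7m4.HPP ∧ Matroid.F7m4.StronglyRayleigh) ∧
    (Matroid.W3plus.HPP ∧ Matroid.W3plus.StronglyRayleigh) ∧
    (Matroid.W3adde.HPP ∧ Matroid.W3adde.StronglyRayleigh) ∧
    (Matroid.P7prime.HPP ∧ Matroid.P7prime.StronglyRayleigh) ∧
    ((Matroid.nonPappus.delete {1}).HPP ∧ (Matroid.nonPappus.delete {1}).StronglyRayleigh) ∧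
    ((Matroid.nonPappus.delete {9}).HPP ∧ (Matroid.nonPappus.delete {9}).StronglyRayleigh) ∧
    (Matroid.vamos.HPP ∧ Matroid.vamos.StronglyRayleigh) :=
  ⟨Matroid.paving_hpp isStronglyRayleigh_F7m4, Matroid.paving_hpp isStronglyRayleigh_W3plus,
    Matroid.paving_hpp isStronglyRayleigh_W3adde, Matroid.paving_hpp isStronglyRayleigh_P7prime,
    Matroid.paving_delete_hpp (by decide) (by decide +kernel)
      isStronglyRayleigh_nonPappus_delete_one,
    Matroid.paving_delete_hpp (by decide) (by decide +kernel)
      isStronglyRayleigh_nonPappus_delete_nine,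
    Matroid.paving_hpp isStronglyRayleigh_vamos⟩
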